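/- **Setting.** Let $n,r\ge 1$. For an observed table $x=(x_{ij})$ and a table $e=(e_{ij})$ of positive expected values, both of size $n\times r$, put $$\chi^2(x,e)=\sum_{i=1}^n\sum_{j=1}^r\frac{(x_{ij}-e_{ij})^2}{e_{ij}},\qquad df=\begin{cases}(n-1)(r-1), & r>1,\\ n-1, & r=1.\end{cases}$$ For $df\ge 1$ and $0<\alpha<1$ let $\chi^2_{df,\alpha}$ be the $(1-\alpha)$-quantile of the chi-squared distribution with $df$ degrees of freedom. The entries of $x$ and $e$ are non-negative binary fixed-point numbers of $w$ bits, $q$ of them after the binary point (that is, numbers $k/2^q$ with $0\le k<2^w$), so that a pair $(x,e)$ is a computational basis state $|x,e\rangle$ of $2nrw$ data qubits. A *quantum neural network* (QNN) on the data qubits is a quantum circuit on the data qubits, finitely many auxiliary qubits and one sink qubit, the latter two kinds initially in the state $|0\rangle$. It consists of successive layers, each a finite family of one-qubit and two-qubit unitary gates acting on pairwise disjoint sets of qubits, followed by a sink gate, which measures the sink qubit in the computational basis and removes it. Its *size* is the number of gates and its *depth* (parallel running time) is the number of layers, the sink gate included as one gate in one last layer. The network *passes* a unit data state $\psi$ to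 the next layer if with probability $1$ the outcome is $1$ and the remaining qubits are then in the state $\psi\otimes|0\cdots0\rangle$; it is *sunk* on $\psi$ if with probability $1$ the outcome is $0$. **Theorem.** The $\chi^2$-test is solved by a QNN with complexity (depth) $O(\sqrt{df})$, i.e. $O(\sqrt{(n-1)(r-1)})$ when $r>1$, and with polynomial size. Precisely: for every precision $w$ there is a constant $C\in\mathbb N$, depending only on $w$, such that for all $n,r$ with $df\ge1$, all integers $q\ge0$ and all $\alpha\in(0,1)$ there is a QNN of depth at most $C\sqrt{df}$ and size at most $C(nr)^C$ with the following property. Let $\psi$ be a unit state of the data qubits that is a superposition of basis states $|x,e\rangle$ with all $e_{ij}>0$. If all basis states occurring in $\psi$ satisfy $\chi^2(x,e)<\chi^2_{df,\alpha}$, then the network passes $\psi$ to the next layer; if all of them satisfy $\chi^2(x,e)\ge\chi^2_{df,\alpha}$, then the network is sunk on $\psi$. -/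

import Mathlib

open scoped BigOperators

noncomputable section

/-! ### The chi-squared test -/

/-- Degrees of freedom of an `n × r` table: `n - 1` for a single column, `(n - 1)(r - 1)`
otherwise. -/
def degreesOfFreedom (n r : ℕ) : ℕ :=
  if r = 1 then n - 1 else (n - 1) * (r - 1)

/-- The chi-squared distribution with `k` degrees of freedom, that is the Gamma distribution of
shape `k / 2` and rate `1 / 2`. -/
def chiSquaredMeasure (k : ℕ) : MeasureTheory.Measure ℝ :=
  ProbabilityTheory.gammaMeasure ((k : ℝ) / 2) (1 / 2)

/-- The critical value of level `α`: the `(1 - α)`-quantile of the chi-squared distribution with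
`k` degrees of freedom. -/
def chiSquaredCritical (k : ℕ) (α : ℝ) : ℝ :=
  sInf {c : ℝ | ENNReal.ofReal (1 - α) ≤ chiSquaredMeasure k (Set.Iic c)}

/-- The chi-squared statistic of the observed table `x` and the table `e` of expected values. -/
def chiSquaredStat {n r : ℕ} (x e : Fin n → Fin r → ℝ) : ℝ :=
  ∑ i, ∑ j, (x i j - e i j) ^ 2 / e i j

/-! ### Quantum circuits on a set of wires -/

/-- (Not necessarily normalised) state vectors of qubits labelled by `W`, given by their
amplitudes in the computational basis; `true` stands for the basis value 1. -/
abbrev QState (W : Type) : Type := (W → Bool) → ℂ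

/-- The total probability (squared norm) of a state vector. -/
def QState.prob {W : Type} [Fintype W] [DecidableEq W] (ψ : QState W) : ℝ :=
  ∑ x, ‖ψ x‖ ^ 2

/-- One-qubit and two-qubit unitary gates. -/
inductive QGate (W : Type) : Type
  | one (U : Matrix.unitaryGroup Bool ℂ) (a : W) : QGate W
  | two (U : Matrix.unitaryGroup (Bool × Bool) ℂ) (a b : W) (hab : a ≠ b) : QGate W

/-- The wires on which a gate acts. -/
def QGate.wires {W : Type} [DecidableEq W] : QGate W → Finset W
  | .one _ a => {a}
  | .two _ a b _ => {a, b}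

/-- The action of a gate on state vectors (the identity on all other wires). -/
def QGate.apply {W : Type} [DecidableEq W] : QGate W → QState W → QState W
  | .one U a, ψ => fun x =>
      ∑ y : Bool, (U : Matrix Bool Bool ℂ) (x a) y * ψ (Function.update x a y)
  | .two U a b _, ψ => fun x =>
      ∑ y : Bool × Bool, (U : Matrix (Bool × Bool) (Bool × Bool) ℂ) (x a, x b) y *
        ψ (Function.update (Function.update x a y.1) b y.2)

/-- A layer of a circuit: finitely many gates acting on pairwise disjoint sets of wires, so that
they can be carried out in parallel. -/
structure QLayer (W : Type) [DecidableEq W] : Type where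
  gates : List (QGate W)
  parallel : gates.Pairwise (fun g h => Disjoint g.wires h.wires)

/-- The action of a layer (its gates commute, so their order is irrelevant). -/
def QLayer.apply {W : Type} [DecidableEq W] (L : QLayer W) (ψ : QState W) : QState W :=
  L.gates.foldl (fun φ g => g.apply φ) ψ

/-! ### Quantum neural networks with a sink gate -/

/-- The wires of a network with data qubits `D` and `a` auxiliary qubits: these, and the qubit
`none`, which is measured by the sink gate. -/
abbrev QNNWire (D : Type) (a : ℕ) : Type := Option (D ⊕ Fin a)

/-- A quantum neural network on the data qubits `D`: a list of layers of gates, followed by the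
sink gate, which measures the qubit `none`. -/
structure QNN (D : Type) [DecidableEq D] : Type where
  anc : ℕ
  layers : List (QLayer (QNNWire D anc))

namespace QNN

variable {D : Type} [DecidableEq D]

/-- The depth: the number of layers, the sink gate being the last one. -/
def depth (N : QNN D) : ℕ := N.layers.length + 1

/-- The size: the number of gates, including the sink gate. -/
def size (N : QNN D) : ℕ := (N.layers.map (fun L => L.gates.length)).sum + 1

/-- The state `ψ` of the data qubits together with auxiliary qubits in the state 0. -/
def withAnc (N : QNN D) (ψ : QState D) : QState (D ⊕ Fin N.anc) :=
  fun z => if ∀ k, z (Sum.inr k) = false then ψ (fun d => z (Sum.inl d)) else 0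

/-- The source of the network: data in the state `ψ`, every other qubit in the state 0. -/
def source (N : QNN D) (ψ : QState D) : QState (QNNWire D N.anc) :=
  fun y => if y none = false then N.withAnc ψ (fun z => y (some z)) else 0

/-- The state just before the sink gate. -/
def run (N : QNN D) (ψ : QState D) : QState (QNNWire D N.anc) :=
  N.layers.foldl (fun φ L => L.apply φ) (N.source ψ)

/-- The (unnormalised) state that remains on the data and auxiliary qubits after the sink gate has
measured the outcome `o` and has removed the measured qubit. -/
def branch (N : QNN D) (ψ : QState D) (o : Bool) : QState (D ⊕ Fin N.anc) :=
  fun z => N.run ψ (fun y => y.elim o z)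

/-- With certainty the sink gate measures 1, and the state handed to the next layer is the input
state, with clean auxiliary qubits. -/
def Passes [Fintype D] (N : QNN D) (ψ : QState D) : Prop :=
  (N.branch ψ true).prob = 1 ∧ N.branch ψ true = N.withAnc ψ

/-- With certainty the sink gate measures 0: the network is sunk. -/
def Sinks [Fintype D] (N : QNN D) (ψ : QState D) : Prop :=
  (N.branch ψ false).prob = 1

end QNN

/-! ### The chi-squared test as a task for a network -/

/-- The data qubits: `w` bits for each observed value (`Sum.inl`) and for each expected value
(`Sum.inr`) of an `n × r` table. -/
abbrev TableQubit (n r w : ℕ) : Type :=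
  (Fin n × Fin r × Fin w) ⊕ (Fin n × Fin r × Fin w)

/-- The non-negative number with binary digits `v` (least significant first), the last `q` of
which stand after the binary point. -/
def fixedPoint {w : ℕ} (q : ℕ) (v : Fin w → Bool) : ℝ :=
  (∑ t : Fin w, if v t then (2 : ℝ) ^ (t : ℕ) else 0) / 2 ^ q

/-- The observed table encoded by a basis state. -/
def observed {n r w : ℕ} (q : ℕ) (d : TableQubit n r w → Bool) : Fin n → Fin r → ℝ :=
  fun i j => fixedPoint q (fun t => d (Sum.inl (i, j, t)))

/-- The table of expected values encoded by a basis state. -/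
def expected {n r w : ℕ} (q : ℕ) (d : TableQubit n r w → Bool) : Fin n → Fin r → ℝ :=
  fun i j => fixedPoint q (fun t => d (Sum.inr (i, j, t)))

/-- The constraint of the chi-squared test: the statistic is below the critical value. -/
def TestHolds {n r w : ℕ} (q : ℕ) (α : ℝ) (d : TableQubit n r w → Bool) : Prop :=
  chiSquaredStat (observed q d) (expected q d) <
    chiSquaredCritical (degreesOfFreedom n r) α

/-- The network carries out the chi-squared test of level `α` as its training rule: a state
composed of tables (with positive expected values) that satisfy the constraint is passed to the next
layer, and on a state composed of tables that violate it the network is sunk. -/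
def QNN.SolvesChiSquaredTest {n r w : ℕ} (N : QNN (TableQubit n r w)) (q : ℕ) (α : ℝ) : Prop :=
  ∀ ψ : QState (TableQubit n r w), ψ.prob = 1 →
    (∀ d, ψ d ≠ 0 → ∀ i j, 0 < expected q d i j) →
    ((∀ d, ψ d ≠ 0 → TestHolds q α d) → N.Passes ψ) ∧
    ((∀ d, ψ d ≠ 0 → ¬ TestHolds q α d) → N.Sinks ψ)

end

noncomputable section

/-! ### Gates that act independently -/

/-! A cell with entries `l / 2 ^ q` and `k / 2 ^ q` contributes `(l - k) ^ 2 / (k * 2 ^ q)` to the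
statistic. Since `1 ≤ k ≤ 2 ^ w`, multiplying by `(2 ^ w)! * 2 ^ q` turns this into a natural number
bounded by some `B` that depends only on `w`. The test therefore asks whether a sum of `n * r`
bounded naturals lies below an integer threshold `T` (`testHolds_iff`). The level `α` enters only
through `T`; no property of the chi-squared distribution is needed.

To compare the sum with `T`, each cell writes its value in unary into `B` bits, all cells in
parallel and in a number of layers depending only on `w` (`CGate.exists_adds`,
`Wiring.run_inputLayers`). Batcher's odd-even merge sort then sorts the `2 ^ p ≥ n * r * B` bits in
at most `p ^ 2` columns (`SortColumn.evalList_sort`). In the sorted sequence bit `i` says whether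
`i` is less than the sum, so the answer is read off a single bit (`Wiring.exists_count`).

The circuit consists of reversible gates on at most three wires, and each of them is a product of
five two-qubit unitaries (`CGate.Valid.exists_gates`). Computing, adding the answer to the sink
qubit and uncomputing leaves the data and auxiliary qubits unchanged, so a superposition whose basis
states all give the same answer survives intact (`exists_qnn_of_circuit`). The depth is `O(p ^ 2)`,
hence `O(log (n * r) ^ 2)` for fixed `w`, which is `O(√df)` because `n * r ≤ 4 * df` and `p ^ 4 =
O(2 ^ p)`. -/

theorem QGate.apply_comm {W : Type} [DecidableEq W] (g h : QGate W)
    (hgh : Disjoint g.wires h.wires) (ψ : QState W) :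
    g.apply (h.apply ψ) = h.apply (g.apply ψ) := by
  funext x
  cases g with
  | one U a =>
    cases h with
    | one V c =>
      have hac : a ≠ c := by simpa [QGate.wires, eq_comm] using hgh
      simp only [QGate.apply, Finset.mul_sum, ne_eq, hac, hac.symm, not_false_eq_true,
        Function.update_of_ne]
      rw [Finset.sum_comm]
      refine Finset.sum_congr rfl fun y _ => Finset.sum_congr rfl fun z _ => ?_
      rw [Function.update_comm hac.symm, mul_left_comm]
    | two V c d hcd =>
      obtain ⟨hac, had⟩ : a ≠ c ∧ a ≠ d := by simpa [QGate.wires, eq_comm] using hgh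
      simp only [QGate.apply, Finset.mul_sum, ne_eq, hac, hac.symm, had, had.symm,
        not_false_eq_true, Function.update_of_ne]
      rw [Finset.sum_comm]
      refine Finset.sum_congr rfl fun y _ => Finset.sum_congr rfl fun z _ => ?_
      rw [Function.update_comm had.symm, Function.update_comm hac.symm, mul_left_comm]
  | two U a b hab =>
    cases h with
    | one V c =>
      obtain ⟨hac, hbc⟩ : a ≠ c ∧ b ≠ c := by simpa [QGate.wires, eq_comm] using hgh
      simp only [QGate.apply, Finset.mul_sum, ne_eq, hac, hac.symm, hbc, hbc.symm,
        not_false_eq_true, Function.update_of_ne]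
      rw [Finset.sum_comm]
      refine Finset.sum_congr rfl fun y _ => Finset.sum_congr rfl fun z _ => ?_
      rw [Function.update_comm hbc, Function.update_comm hac, mul_left_comm]
    | two V c d hcd =>
      obtain ⟨⟨hac, had⟩, hbc, hbd⟩ : (a ≠ c ∧ a ≠ d) ∧ b ≠ c ∧ b ≠ d := by
        simp only [QGate.wires, Finset.disjoint_left, Finset.mem_insert, Finset.mem_singleton]
          at hgh
        refine ⟨⟨?_, ?_⟩, ?_, ?_⟩ <;> rintro rfl <;> simp at hgh
      simp only [QGate.apply, Finset.mul_sum, ne_eq, hac, hac.symm, hbc, hbc.symm, had, had.symm,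
        hbd, hbd.symm, not_false_eq_true, Function.update_of_ne]
      rw [Finset.sum_comm]
      refine Finset.sum_congr rfl fun y _ => Finset.sum_congr rfl fun z _ => ?_
      rw [Function.update_comm had.symm, Function.update_comm hbd.symm,
        Function.update_comm hac.symm, Function.update_comm hbc.symm, mul_left_comm]

/-- The action of a sequence of gates. -/
def QGate.applyList {W : Type} [DecidableEq W] (l : List (QGate W)) (ψ : QState W) : QState W :=
  l.foldl (fun φ g => g.apply φ) ψ

theorem QGate.applyList_append {W : Type} [DecidableEq W] (l l' : List (QGate W))
    (ψ : QState W) :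
    QGate.applyList (l ++ l') ψ = QGate.applyList l' (QGate.applyList l ψ) :=
  List.foldl_append

theorem QGate.applyList_apply_comm {W : Type} [DecidableEq W] (g : QGate W) (l : List (QGate W))
    (h : ∀ k ∈ l, Disjoint g.wires k.wires) (ψ : QState W) :
    QGate.applyList l (g.apply ψ) = g.apply (QGate.applyList l ψ) := by
  induction l generalizing ψ with
  | nil => rfl
  | cons k l ih =>
    rw [List.forall_mem_cons] at h
    change QGate.applyList l (k.apply (g.apply ψ)) = g.apply (QGate.applyList l (k.apply ψ))
    rw [← g.apply_comm k h.1, ih h.2]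

theorem QGate.applyList_comm {W : Type} [DecidableEq W] (l l' : List (QGate W))
    (h : ∀ g ∈ l, ∀ k ∈ l', Disjoint g.wires k.wires) (ψ : QState W) :
    QGate.applyList l (QGate.applyList l' ψ) = QGate.applyList l' (QGate.applyList l ψ) := by
  induction l generalizing ψ with
  | nil => rfl
  | cons g l ih =>
    rw [List.forall_mem_cons] at h
    change QGate.applyList l (g.apply (QGate.applyList l' ψ)) =
      QGate.applyList l' (QGate.applyList l (g.apply ψ))
    rw [← QGate.applyList_apply_comm g l' h.1, ih h.2]

/-- Running a sequence of gates alongside layers on other wires. -/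
theorem QGate.applyList_flatten_zipWith_cons {W : Type} [DecidableEq W] (gs : List (QGate W))
    (Ls : List (List (QGate W))) (hlen : gs.length = Ls.length)
    (h : ∀ g ∈ gs, ∀ l ∈ Ls, ∀ k ∈ l, Disjoint g.wires k.wires) (ψ : QState W) :
    QGate.applyList (List.zipWith List.cons gs Ls).flatten ψ =
      QGate.applyList Ls.flatten (QGate.applyList gs ψ) := by
  induction gs generalizing Ls ψ with
  | nil =>
    obtain rfl := List.eq_nil_of_length_eq_zero hlen.symm
    rfl
  | cons g gs ih =>
    cases Ls with
    | nil => simp at hlen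
    | cons l Ls =>
      have h' : ∀ g ∈ gs, ∀ l ∈ Ls, ∀ k ∈ l, Disjoint g.wires k.wires := fun g hg l hl =>
        h g (List.mem_cons_of_mem _ hg) l (List.mem_cons_of_mem _ hl)
      rw [List.zipWith_cons_cons, List.flatten_cons, List.flatten_cons, QGate.applyList_append,
        QGate.applyList_append, ih Ls (by simpa using hlen) h']
      change QGate.applyList Ls.flatten (QGate.applyList gs (QGate.applyList l (g.apply ψ))) =
        QGate.applyList Ls.flatten (QGate.applyList l (QGate.applyList gs (g.apply ψ)))
      rw [QGate.applyList_comm gs l fun g hg => h g (List.mem_cons_of_mem _ hg) l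
        List.mem_cons_self]

/-! ### Controlled rotations -/

/-- The rotation with eigenvalue `1` on `|0⟩ + |1⟩` and eigenvalue `z` on `|0⟩ - |1⟩`. -/
def rotMatrix (z : ℂ) : Matrix Bool Bool ℂ :=
  Matrix.of fun x y => if x = y then (1 + z) / 2 else (1 - z) / 2

theorem rotMatrix_conjTranspose_mul {z : ℂ} (hz : ‖z‖ = 1) :
    (rotMatrix z).conjTranspose * rotMatrix z = 1 := by
  have h : starRingEnd ℂ z * z = 1 := by
    rw [mul_comm, Complex.mul_conj, Complex.normSq_eq_norm_sq, hz]; norm_num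
  ext x y
  have h2 : starRingEnd ℂ 2 = 2 := Complex.conj_ofNat 2
  cases x <;> cases y <;>
    simp [rotMatrix, Matrix.mul_apply, h2]
  · linear_combination h / 2
  · linear_combination -h / 2
  · linear_combination -h / 2
  · linear_combination h / 2

/-- The rotation by `z s` of the first qubit, where `s` is the value of the second one. -/
def ctlRot (z : Bool → ℂ) (hz : ∀ s, ‖z s‖ = 1) : Matrix.unitaryGroup (Bool × Bool) ℂ :=
  ⟨Matrix.blockDiagonal fun s => rotMatrix (z s), by
    rw [Matrix.mem_unitaryGroup_iff', Matrix.star_eq_conjTranspose,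
      Matrix.blockDiagonal_conjTranspose, ← Matrix.blockDiagonal_mul]
    simp only [rotMatrix_conjTranspose_mul (hz _)]
    exact Matrix.blockDiagonal_one⟩

/-- The basis state with wire `t` negated. -/
def flipWire {W : Type} [DecidableEq W] (t : W) (x : W → Bool) : W → Bool :=
  Function.update x t (!x t)

/-- The rotation of wire `t` by a phase that depends on the basis state. -/
def rotate {W : Type} [DecidableEq W] (t : W) (φ : (W → Bool) → ℂ) (ψ : QState W) : QState W :=
  fun x => (1 + φ x) / 2 * ψ x + (1 - φ x) / 2 * ψ (flipWire t x)

theorem flipWire_flipWire {W : Type} [DecidableEq W] (t : W) (x : W → Bool) :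
    flipWire t (flipWire t x) = x := by
  simp [flipWire]

theorem flipWire_of_ne {W : Type} [DecidableEq W] {s t : W} (h : s ≠ t) (x : W → Bool) :
    flipWire t x s = x s :=
  Function.update_of_ne h _ _

/-- All rotations of one wire are diagonal in the same basis `|0⟩ ± |1⟩`, so phases multiply,
provided that the inner phase does not depend on the rotated wire itself. -/
theorem rotate_rotate {W : Type} [DecidableEq W] (t : W) (φ φ' : (W → Bool) → ℂ)
    (h : ∀ x, φ' (flipWire t x) = φ' x) (ψ : QState W) :
    rotate t φ (rotate t φ' ψ) = rotate t (fun x => φ x * φ' x) ψ := by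
  funext x
  simp only [rotate, h, flipWire_flipWire]
  ring

/-- Phase `-1` on `|0⟩ - |1⟩` is the NOT gate and phase `1` is the identity. A reversible gate is
thus a rotation by a sign depending on its controls. -/
theorem rotate_sign {W : Type} [DecidableEq W] (t : W) (f : (W → Bool) → Bool) (ψ : QState W) :
    rotate t (fun x => if f x then -1 else 1) ψ =
      fun x => ψ (Function.update x t (x t ^^ f x)) := by
  funext x
  cases h : f x <;> simp [rotate, h, flipWire]

theorem ctlRot_apply {W : Type} [DecidableEq W] (z : Bool → ℂ) (hz : ∀ s, ‖z s‖ = 1) (t s : W)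
    (hts : t ≠ s) (ψ : QState W) :
    (QGate.two (ctlRot z hz) t s hts).apply ψ = rotate t (fun x => z (x s)) ψ := by
  funext x
  have hs : ∀ b, Function.update (Function.update x t b) s (x s) = Function.update x t b :=
    fun b => by rw [Function.update_eq_self_iff, Function.update_of_ne hts.symm]
  cases ht : x t <;> cases hxs : x s <;> rw [hxs] at hs <;>
    simp [QGate.apply, ctlRot, rotMatrix, Fintype.sum_prod_type, rotate, flipWire,
      Matrix.blockDiagonal_apply, ht, hxs, hs] <;>
    simp [← ht] <;> ring

/-! ### Reversible gates on basis states -/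

/-- The reversible gate that adds `fn fst snd` to the target bit. -/
structure CGate (W : Type) : Type where
  tgt : W
  fst : W
  snd : W
  fn : Bool → Bool → Bool

namespace CGate

variable {W : Type}

/-- The gate does not read its own target. -/
def Valid (g : CGate W) : Prop := g.fst ≠ g.tgt ∧ g.snd ≠ g.tgt

/-- The gate on the wires given by `e`. -/
def map {X : Type} (e : X → W) (g : CGate X) : CGate W :=
  ⟨e g.tgt, e g.fst, e g.snd, g.fn⟩

variable [DecidableEq W]

/-- The wires of a reversible gate. -/
def wires (g : CGate W) : Finset W := {g.tgt, g.fst, g.snd}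

/-- The action on basis states. -/
def act (g : CGate W) (x : W → Bool) : W → Bool :=
  Function.update x g.tgt (x g.tgt ^^ g.fn (x g.fst) (x g.snd))

/-- The action of a sequence of gates on basis states. -/
def run (l : List (CGate W)) (x : W → Bool) : W → Bool :=
  l.foldl (fun y g => g.act y) x

theorem run_append (l l' : List (CGate W)) (x : W → Bool) :
    run (l ++ l') x = run l' (run l x) :=
  List.foldl_append

theorem run_cons (g : CGate W) (l : List (CGate W)) (x : W → Bool) :
    run (g :: l) x = run l (g.act x) :=
  rfl

theorem Valid.act_act {g : CGate W} (hg : g.Valid) (x : W → Bool) : g.act (g.act x) = x := by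
  simp [act, hg.1, hg.2]

theorem run_reverse_run (l : List (CGate W)) (hl : ∀ g ∈ l, g.Valid) (x : W → Bool) :
    run l.reverse (run l x) = x := by
  induction l generalizing x with
  | nil => rfl
  | cons g l ih =>
    rw [List.forall_mem_cons] at hl
    rw [List.reverse_cons, run_append, run_cons g l, ih hl.2]
    exact hl.1.act_act x

/-- Lets the uncomputation ignore a change made meanwhile to an untouched wire, namely the sink. -/
theorem run_update (l : List (CGate W)) (s : W) (hl : ∀ g ∈ l, s ∉ g.wires) (b : Bool)
    (x : W → Bool) : run l (Function.update x s b) = Function.update (run l x) s b := by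
  induction l generalizing x with
  | nil => rfl
  | cons g l ih =>
    rw [List.forall_mem_cons] at hl
    obtain ⟨h1, h2, h3⟩ : s ≠ g.tgt ∧ s ≠ g.fst ∧ s ≠ g.snd := by
      simpa [wires, not_or] using hl.1
    rw [run_cons, run_cons, ← ih hl.2, act, act, Function.update_of_ne h1.symm,
      Function.update_of_ne h2.symm, Function.update_of_ne h3.symm, Function.update_comm h1]

theorem run_of_forall_ne (l : List (CGate W)) (w : W) (hl : ∀ g ∈ l, w ≠ g.tgt) (x : W → Bool) :
    run l x w = x w := by
  induction l generalizing x with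
  | nil => rfl
  | cons g l ih =>
    rw [List.forall_mem_cons] at hl
    rw [run_cons, ih hl.2, act, Function.update_of_ne hl.1]

theorem run_tgt (l : List (CGate W)) (hl : l.Pairwise fun g h => Disjoint g.wires h.wires)
    (g : CGate W) (hg : g ∈ l) (x : W → Bool) :
    run l x g.tgt = (x g.tgt ^^ g.fn (x g.fst) (x g.snd)) := by
  induction l generalizing x with
  | nil => simp at hg
  | cons h l ih =>
    rw [List.pairwise_cons] at hl
    rw [run_cons]
    rcases List.mem_cons.1 hg with rfl | hg
    · rw [run_of_forall_ne, act, Function.update_self]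
      intro k hk e
      exact Finset.disjoint_left.1 (hl.1 k hk) (show g.tgt ∈ g.wires by simp [wires]) (by simp [wires, e])
    · have hd := Finset.disjoint_right.1 (hl.1 g hg)
      have h1 : g.tgt ≠ h.tgt := fun e => hd (show g.tgt ∈ g.wires by simp [wires]) (by simp [wires, e])
      have h2 : g.fst ≠ h.tgt := fun e => hd (show g.fst ∈ g.wires by simp [wires]) (by simp [wires, e])
      have h3 : g.snd ≠ h.tgt := fun e => hd (show g.snd ∈ g.wires by simp [wires]) (by simp [wires, e])
      rw [ih hl.2 hg, act, Function.update_of_ne h1, Function.update_of_ne h2,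
        Function.update_of_ne h3]

end CGate

/-! ### Three-wire gates from two-qubit unitaries -/

/-- Put `ε = (-1) ^ f`, normalise `z₂ false = z₃ false = 1` and `z₁ false = ε false false`, and let
`g = z₃ true`. The mixed inputs determine `z₁ true` and `z₂ true`, and the input `(true, true)` then
requires `g ^ 2` to be the product of the four signs. So `g` can be `1` or `I`. -/
theorem exists_phases (f : Bool → Bool → Bool) :
    ∃ z₁ z₂ z₃ : Bool → ℂ, (∀ s, ‖z₁ s‖ = 1) ∧ (∀ s, ‖z₂ s‖ = 1) ∧ (∀ s, ‖z₃ s‖ = 1) ∧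
      ∀ a b, z₁ a * z₂ b * z₃ (a ^^ b) = if f a b then -1 else 1 := by
  let ε : Bool → Bool → ℂ := fun a b => if f a b then -1 else 1
  have hε : ∀ a b, ε a b = 1 ∨ ε a b = -1 := fun a b => by
    by_cases h : f a b <;> simp [ε, h]
  have hn : ∀ a b, ‖ε a b‖ = 1 := fun a b => by rcases hε a b with h | h <;> simp [h]
  have h2 : ∀ a b, ε a b * ε a b = 1 := fun a b => by rcases hε a b with h | h <;> simp [h]
  obtain ⟨g, hg, hgg⟩ : ∃ g : ℂ, ‖g‖ = 1 ∧
      g * g = ε false false * ε false true * ε true false * ε true true := by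
    have : ε false false * ε false true * ε true false * ε true true = 1 ∨
        ε false false * ε false true * ε true false * ε true true = -1 := by
      rcases hε false false with a | a <;> rcases hε false true with b | b <;>
        rcases hε true false with c | c <;> rcases hε true true with d | d <;> simp [a, b, c, d]
    rcases this with h | h <;> rw [h]
    · exact ⟨1, by simp⟩
    · exact ⟨Complex.I, by simp⟩
  have hg0 : g ≠ 0 := fun h => by simp [h] at hg
  refine ⟨fun a => if a then ε true false / g else ε false false,
    fun b => if b then ε false true * ε false false / g else 1,
    fun s => if s then g else 1, ?_, ?_, ?_, ?_⟩
  · rintro (_ | _) <;> simp [hn, hg]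
  · rintro (_ | _) <;> simp [hn, hg]
  · rintro (_ | _) <;> simp [hg]
  · intro a b
    change _ = ε a b
    cases a <;> cases b <;> simp <;> field_simp
    · linear_combination ε false true * h2 false false
    · rw [sq, hgg]
      linear_combination (-ε true false * ε false true * ε false false) * h2 true true

/-- A reversible gate is a sequence of five controlled rotations. -/
theorem CGate.Valid.exists_gates {W : Type} [DecidableEq W] {g : CGate W} (hg : g.Valid) :
    ∃ gs : List (QGate W), gs.length = 5 ∧ (∀ k ∈ gs, k.wires ⊆ g.wires) ∧
      ∀ ψ, QGate.applyList gs ψ = fun x => ψ (g.act x) := by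
  obtain ⟨c, a, b, f⟩ := g
  obtain ⟨hac, hbc⟩ := hg
  simp only at hac hbc
  have norm_sign : ∀ p : Bool, ‖(if p then -1 else 1 : ℂ)‖ = 1 := by simp [apply_ite]
  by_cases hab : a = b
  · subst hab
    -- Coinciding controls need one rotation only; identities pad the sequence to length five, so
    -- that parallel gates stay synchronised.
    let i : QGate W := .two 1 c a hac.symm
    have hi : ∀ ψ, i.apply ψ = ψ := by
      intro ψ
      funext x
      simp [i, QGate.apply, Matrix.one_apply]
    refine ⟨[.two (ctlRot (fun s => if f s s then -1 else 1) fun s => norm_sign _) c a hac.symm,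
      i, i, i, i], rfl, ?_, ?_⟩
    · simp [i, QGate.wires, CGate.wires]
    · intro ψ
      simp only [QGate.applyList, List.foldl_cons, List.foldl_nil, hi]
      rw [ctlRot_apply, rotate_sign c (fun x => f (x a) (x a))]
      rfl
  · obtain ⟨z₁, z₂, z₃, h₁, h₂, h₃, h⟩ := exists_phases f
    let X : QGate W := .two (ctlRot (fun s => if s then -1 else 1) fun s => norm_sign _) b a
      (Ne.symm hab)
    have hX : ∀ ψ, X.apply ψ = fun x => ψ (Function.update x b (x b ^^ x a)) := fun ψ => by
      simp only [X]
      rw [ctlRot_apply, rotate_sign b (fun x => x a)]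
    refine ⟨[.two (ctlRot z₁ h₁) c a hac.symm, .two (ctlRot z₂ h₂) c b hbc.symm, X,
      .two (ctlRot z₃ h₃) c b hbc.symm, X], rfl, ?_, ?_⟩
    · simp [X, QGate.wires, CGate.wires, Finset.insert_subset_iff]
    · intro ψ
      -- Conjugating by the controlled NOT `X` places `a ^^ b` on wire `b`, where it can control the
      -- third rotation.
      have key : ∀ φ : QState W, X.apply
          ((QGate.two (ctlRot z₃ h₃) c b hbc.symm).apply (X.apply φ)) =
            rotate c (fun x => z₃ (x a ^^ x b)) φ := by
        intro φ
        rw [hX, hX, ctlRot_apply]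
        funext x
        have e2 : flipWire c (Function.update x b (x b ^^ x a)) =
            Function.update (flipWire c x) b (x b ^^ x a) := by
          rw [flipWire, flipWire, Function.update_of_ne hbc.symm, Function.update_comm hbc]
        have e3 : Function.update (flipWire c x) b (x b) = flipWire c x := by
          rw [Function.update_eq_self_iff, flipWire_of_ne hbc]
        simp only [rotate, e2, Function.update_self, Function.update_idem, Function.update_eq_self,
          Function.update_of_ne hab, flipWire_of_ne hac, Bool.xor_assoc, Bool.xor_self,
          Bool.xor_false, e3]
        rw [Bool.xor_comm]
      simp only [QGate.applyList, List.foldl_cons, List.foldl_nil]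
      rw [key, ctlRot_apply, ctlRot_apply, rotate_rotate, rotate_rotate]
      · have : (fun x : W → Bool => z₃ (x a ^^ x b) * (z₂ (x b) * z₁ (x a))) =
            fun x => if f (x a) (x b) then -1 else 1 := by
          funext x
          rw [← h]; ring
        simp only [mul_assoc]
        rw [this, rotate_sign c (fun x => f (x a) (x b))]
        rfl
      · intro x; simp only [flipWire_of_ne hac]
      · intro x; simp only [flipWire_of_ne hbc]

/-! ### Batcher's odd-even merge sort -/

/-- A column of a sorting network: output `i` is computed from the inputs `src i` and `aux i`. -/
structure SortColumn : Type where
  src : ℕ → ℕ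
  aux : ℕ → ℕ
  fn : ℕ → Bool → Bool → Bool

namespace SortColumn

/-- The column acts on `N` bits and uses each of them at most once as `src` and as `aux`. -/
structure Valid (N : ℕ) (s : SortColumn) : Prop where
  src_lt : ∀ i < N, s.src i < N
  aux_lt : ∀ i < N, s.aux i < N
  src_inj : ∀ i < N, ∀ j < N, s.src i = s.src j → i = j
  aux_inj : ∀ i < N, ∀ j < N, s.aux i = s.aux j → i = j

/-- The output of a column. -/
def eval (s : SortColumn) (v : ℕ → Bool) : ℕ → Bool :=
  fun i => s.fn i (v (s.src i)) (v (s.aux i))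

/-- The output of a sequence of columns. -/
def evalList (l : List SortColumn) (v : ℕ → Bool) : ℕ → Bool :=
  l.foldl (fun v s => s.eval v) v

theorem evalList_append (l l' : List SortColumn) (v : ℕ → Bool) :
    evalList (l ++ l') v = evalList l' (evalList l v) :=
  List.foldl_append

/-- The column applied separately to the bits in even and in odd position. -/
def parity (s : SortColumn) : SortColumn where
  src i := 2 * s.src (i / 2) + i % 2
  aux i := 2 * s.aux (i / 2) + i % 2
  fn i := s.fn (i / 2)

theorem Valid.parity {N : ℕ} {s : SortColumn} (h : s.Valid N) : s.parity.Valid (2 * N) where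
  src_lt i hi := by
    have := h.src_lt (i / 2) (by omega)
    simp only [SortColumn.parity]; omega
  aux_lt i hi := by
    have := h.aux_lt (i / 2) (by omega)
    simp only [SortColumn.parity]; omega
  src_inj i hi j hj e := by
    simp only [SortColumn.parity] at e
    have := h.src_inj (i / 2) (by omega) (j / 2) (by omega) (by omega)
    omega
  aux_inj i hi j hj e := by
    simp only [SortColumn.parity] at e
    have := h.aux_inj (i / 2) (by omega) (j / 2) (by omega) (by omega)
    omega

theorem evalList_parity (l : List SortColumn) (v : ℕ → Bool) (i c : ℕ) (hc : c < 2) :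
    evalList (l.map parity) v (2 * i + c) = evalList l (fun j => v (2 * j + c)) i := by
  induction l generalizing v with
  | nil => rfl
  | cons s l ih =>
    change evalList (l.map parity) (s.parity.eval v) (2 * i + c) =
      evalList l (s.eval fun j => v (2 * j + c)) i
    rw [ih]
    congr 1
    funext j
    have h1 : (2 * j + c) / 2 = j := by omega
    have h2 : (2 * j + c) % 2 = c := by omega
    simp only [eval, parity, h1, h2]

/-- The column applied separately to the first and to the second `N` bits. -/
def halves (N : ℕ) (s : SortColumn) : SortColumn where
  src i := if i < N then s.src i else s.src (i - N) + N
  aux i := if i < N then s.aux i else s.aux (i - N) + N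
  fn i := if i < N then s.fn i else s.fn (i - N)

theorem Valid.halves {N : ℕ} {s : SortColumn} (h : s.Valid N) :
    (s.halves N).Valid (2 * N) where
  src_lt i hi := by
    simp only [SortColumn.halves]
    split
    · have := h.src_lt i ‹_›; omega
    · have := h.src_lt (i - N) (by omega); omega
  aux_lt i hi := by
    simp only [SortColumn.halves]
    split
    · have := h.aux_lt i ‹_›; omega
    · have := h.aux_lt (i - N) (by omega); omega
  src_inj i hi j hj e := by
    simp only [SortColumn.halves] at e
    split at e <;> split at e
    · exact h.src_inj i ‹_› j ‹_› e
    · have := h.src_lt i ‹_›; omega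
    · have := h.src_lt j ‹_›; omega
    · have := h.src_inj (i - N) (by omega) (j - N) (by omega) (by omega)
      omega
  aux_inj i hi j hj e := by
    simp only [SortColumn.halves] at e
    split at e <;> split at e
    · exact h.aux_inj i ‹_› j ‹_› e
    · have := h.aux_lt i ‹_›; omega
    · have := h.aux_lt j ‹_›; omega
    · have := h.aux_inj (i - N) (by omega) (j - N) (by omega) (by omega)
      omega

theorem evalList_halves {N : ℕ} (l : List SortColumn) (hl : ∀ s ∈ l, s.Valid N) (v : ℕ → Bool)
    (i : ℕ) (hi : i < N) :
    evalList (l.map (halves N)) v i = evalList l v i ∧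
      evalList (l.map (halves N)) v (i + N) = evalList l (fun j => v (j + N)) i := by
  -- The columns constrain only indices below `N`, so the induction needs inputs that agree there
  -- and are arbitrary elsewhere.
  suffices H : ∀ v u t : ℕ → Bool, (∀ i < N, v i = u i) → (∀ i < N, v (i + N) = t i) → ∀ i < N,
      evalList (l.map (halves N)) v i = evalList l u i ∧
        evalList (l.map (halves N)) v (i + N) = evalList l t i from
    H v v _ (fun _ _ => rfl) (fun _ _ => rfl) i hi
  clear i hi v
  induction l with
  | nil => exact fun v u t hu ht i hi => ⟨hu i hi, ht i hi⟩
  | cons s l ih =>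
    rw [List.forall_mem_cons] at hl
    intro v u t hu ht
    refine ih hl.2 ((s.halves N).eval v) (s.eval u) (s.eval t) (fun i hi => ?_) fun i hi => ?_
    · simp only [eval, halves, if_pos hi]
      rw [hu _ (hl.1.src_lt i hi), hu _ (hl.1.aux_lt i hi)]
    · simp only [eval, halves, if_neg (show ¬ i + N < N by omega), Nat.add_sub_cancel]
      rw [ht _ (hl.1.src_lt i hi), ht _ (hl.1.aux_lt i hi)]

/-- The column that sorts two bits. -/
def sortTwo : SortColumn where
  src i := i
  aux i := 1 - i
  fn i a b := if i = 0 then a || b else a && b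

/-- The last column of the odd-even merge of `N` bits. -/
def mergeLast (N : ℕ) : SortColumn where
  src i := i
  aux i := if i = 0 ∨ i = N - 1 then i else if i % 2 = 1 then i + 1 else i - 1
  fn i a b := if i % 2 = 1 then a || b else a && b

theorem sortTwo_valid : sortTwo.Valid 2 := by
  constructor <;> simp only [sortTwo] <;> omega

theorem mergeLast_valid (N : ℕ) : (mergeLast (2 * N)).Valid (2 * N) := by
  constructor <;> simp only [mergeLast]
  · omega
  · intro i hi; split_ifs <;> omega
  · omega
  · intro i hi j hj; split_ifs <;> omega

/-- The network that merges two sorted sequences of `2 ^ p` bits. -/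
def merge : ℕ → List SortColumn
  | 0 => [sortTwo]
  | p + 1 => (merge p).map parity ++ [mergeLast (2 ^ (p + 2))]

/-- The network that sorts `2 ^ p` bits. -/
def sort : ℕ → List SortColumn
  | 0 => []
  | p + 1 => (sort p).map (halves (2 ^ p)) ++ merge p

theorem length_merge (p : ℕ) : (merge p).length = p + 1 := by
  induction p with
  | zero => rfl
  | succ p ih => simp [merge, ih]

theorem length_sort_le (p : ℕ) : (sort p).length ≤ p ^ 2 := by
  induction p with
  | zero => simp [sort]
  | succ p ih =>
    simp only [sort, List.length_append, List.length_map, length_merge]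
    nlinarith

theorem merge_valid (p : ℕ) : ∀ s ∈ merge p, s.Valid (2 ^ (p + 1)) := by
  induction p with
  | zero => simpa [merge] using sortTwo_valid
  | succ p ih =>
    simp only [merge, List.mem_append, List.mem_map, List.mem_singleton]
    rw [pow_succ' 2 (p + 1)]
    rintro _ (⟨s, hs, rfl⟩ | rfl)
    exacts [(ih s hs).parity, mergeLast_valid _]

theorem sort_valid (p : ℕ) : ∀ s ∈ sort p, s.Valid (2 ^ p) := by
  induction p with
  | zero => simp [sort]
  | succ p ih =>
    simp only [sort, List.mem_append, List.mem_map]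
    rintro _ (⟨s, hs, rfl⟩ | h)
    · rw [pow_succ']
      exact (ih s hs).halves
    · exact merge_valid p _ h

/-- With `k` and `l` leading ones in the two halves, the even positions hold `⌈k/2⌉ + ⌈l/2⌉` ones
and the odd ones `⌊k/2⌋ + ⌊l/2⌋`. The difference is at most two, so after the recursive merges at
most one pair `(2j+1, 2j+2)` is out of order, and `mergeLast` repairs it. -/
theorem evalList_merge (p : ℕ) (v : ℕ → Bool) (k l : ℕ) (hk : k ≤ 2 ^ p) (hl : l ≤ 2 ^ p)
    (h₀ : ∀ i < 2 ^ p, v i = decide (i < k)) (h₁ : ∀ i < 2 ^ p, v (2 ^ p + i) = decide (i < l)) :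
    ∀ i < 2 ^ (p + 1), evalList (merge p) v i = decide (i < k + l) := by
  induction p generalizing v k l with
  | zero =>
    have a := h₀ 0 (by simp)
    have b := h₁ 0 (by simp)
    simp only [pow_zero, add_zero] at a b hk hl
    intro i hi
    simp only [zero_add, pow_one] at hi
    interval_cases i <;> interval_cases k <;> interval_cases l <;>
      simp [merge, evalList, eval, sortTwo, a, b]
  | succ p ih =>
    have e1 : 2 ^ (p + 1) = 2 * 2 ^ p := pow_succ' 2 p
    have e2 : 2 ^ (p + 1 + 1) = 2 * 2 ^ (p + 1) := pow_succ' 2 (p + 1)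
    have e3 : 2 ^ (p + 2) = 2 * 2 ^ (p + 1) := pow_succ' 2 (p + 1)
    have hE : ∀ i < 2 ^ (p + 1), evalList ((merge p).map parity) v (2 * i) =
        decide (i < (k + 1) / 2 + (l + 1) / 2) := by
      intro i hi
      have := evalList_parity (merge p) v i 0 (by norm_num)
      rw [add_zero] at this
      rw [this]
      refine ih _ _ _ (by omega) (by omega) (fun j hj => ?_) (fun j hj => ?_) i hi
      · rw [h₀ _ (by omega)]; congr 1; apply propext; omega
      · rw [show 2 * (2 ^ p + j) + 0 = 2 ^ (p + 1) + 2 * j by omega, h₁ _ (by omega)]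
        congr 1; apply propext; omega
    have hO : ∀ i < 2 ^ (p + 1), evalList ((merge p).map parity) v (2 * i + 1) =
        decide (i < k / 2 + l / 2) := by
      intro i hi
      rw [evalList_parity (merge p) v i 1 (by norm_num)]
      refine ih _ _ _ (by omega) (by omega) (fun j hj => ?_) (fun j hj => ?_) i hi
      · rw [h₀ _ (by omega)]; congr 1; apply propext; omega
      · rw [show 2 * (2 ^ p + j) + 1 = 2 ^ (p + 1) + (2 * j + 1) by omega, h₁ _ (by omega)]
        congr 1; apply propext; omega
    have hp : 0 < 2 ^ p := by positivity
    intro i hi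
    rw [merge, evalList_append]
    set u := evalList ((merge p).map parity) v with hu
    change (mergeLast (2 ^ (p + 2))).eval u i = _
    simp only [eval, mergeLast]
    obtain ⟨j, rfl | rfl⟩ := i.even_or_odd'
    · rw [if_neg (show ¬ 2 * j % 2 = 1 by omega), if_neg (show ¬ 2 * j % 2 = 1 by omega),
        hE j (by omega)]
      by_cases hj : j = 0
      · subst hj
        simp only [mul_zero, true_or, if_true]
        have := hE 0 (by omega)
        rw [mul_zero] at this
        rw [this, Bool.and_self]
        congr 1; apply propext; omega
      · rw [if_neg (by omega), show 2 * j - 1 = 2 * (j - 1) + 1 by omega, hO _ (by omega),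
          ← Bool.decide_and]
        congr 1; apply propext; omega
    · rw [if_pos (show (2 * j + 1) % 2 = 1 by omega), if_pos (show (2 * j + 1) % 2 = 1 by omega),
        hO j (by omega)]
      by_cases hj : 2 * j + 1 = 2 ^ (p + 2) - 1
      · rw [if_pos (Or.inr hj), hO j (by omega), Bool.or_self]
        congr 1; apply propext; omega
      · rw [if_neg (by omega), show 2 * j + 1 + 1 = 2 * (j + 1) by omega, hE _ (by omega),
          ← Bool.decide_or]
        congr 1; apply propext; omega

theorem evalList_sort (p : ℕ) (v : ℕ → Bool) :
    ∀ i < 2 ^ p, evalList (sort p) v i =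
      decide (i < ∑ j ∈ Finset.range (2 ^ p), (v j).toNat) := by
  induction p generalizing v with
  | zero =>
    intro i hi
    obtain rfl : i = 0 := by simpa using hi
    cases h : v 0 <;> simp [sort, evalList, h]
  | succ p ih =>
    intro i hi
    have hle : ∀ u : ℕ → Bool, ∑ j ∈ Finset.range (2 ^ p), (u j).toNat ≤ 2 ^ p := fun u =>
      (Finset.sum_le_card_nsmul _ _ 1 fun j _ => Bool.toNat_le _).trans (by simp)
    rw [sort, evalList_append, evalList_merge p _ _ _ (hle v) (hle fun j => v (2 ^ p + j)) _ _ i hi,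
      pow_succ, mul_two, Finset.sum_range_add]
    · intro j hj
      rw [(evalList_halves _ (sort_valid p) v j hj).1, ih v j hj]
    · intro j hj
      rw [add_comm, (evalList_halves _ (sort_valid p) v j hj).2, ih _ j hj]
      simp only [add_comm]

end SortColumn

/-! ### Arbitrary Boolean functions with one borrowed wire -/

namespace CGate

/-- The gate sequence `l` adds `g` of the data wires to the wire `inr b`, for both choices of `b`,
using the other one as a borrowed wire. -/
def Adds {V : Type} [DecidableEq V] (l : List (CGate (V ⊕ Bool))) (b : Bool)
    (g : (V → Bool) → Bool) : Prop :=
  (∀ k ∈ l, k.Valid) ∧ ∀ x, run l x =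
    Function.update x (Sum.inr b) (x (Sum.inr b) ^^ g fun v => x (Sum.inl v))

theorem Adds.append {V : Type} [DecidableEq V] {l l' : List (CGate (V ⊕ Bool))} {b : Bool}
    {g g' : (V → Bool) → Bool} (h : Adds l b g) (h' : Adds l' b g') :
    Adds (l ++ l') b fun v => g v ^^ g' v := by
  refine ⟨fun k hk => (List.mem_append.1 hk).elim (h.1 k) (h'.1 k), fun x => ?_⟩
  rw [run_append, h.2, h'.2]
  simp

/-- Let `k` add `[x v = s]` times the other wire to the target, and let `l` add `g` to the other
wire. In `k, l, k, l` the unknown content of the other wire contributes twice and cancels, its own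
change is undone, and the target gains `[x v = s] * g`. -/
theorem Adds.exists_control {V : Type} [DecidableEq V] {l : List (CGate (V ⊕ Bool))} {b : Bool}
    {g : (V → Bool) → Bool} (h : Adds l (!b) g) (v : V) (s : Bool) :
    ∃ l', Adds l' b fun x => (x v == s) && g x := by
  let k : CGate (V ⊕ Bool) := ⟨Sum.inr b, Sum.inr !b, Sum.inl v, fun p q => (q == s) && p⟩
  have hk : k.Valid := by simp [Valid, k]
  refine ⟨k :: (l ++ k :: l), ?_, fun x => ?_⟩
  · simp only [List.mem_cons, List.mem_append]
    rintro _ (rfl | hj | rfl | hj)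
    exacts [hk, h.1 _ hj, hk, h.1 _ hj]
  · rw [run_cons, run_append, run_cons, h.2, h.2]
    funext w
    rcases w with w | w
    · simp [act, k]
    · rcases eq_or_ne w b with rfl | hw
      · simp only [act, k]
        simp
        cases x (Sum.inr w) <;> cases x (Sum.inr !w) <;> cases (x (Sum.inl v) == s) <;> simp
      · obtain rfl : w = !b := by cases w <;> cases b <;> simp_all
        simp [act, k]

/-- Shannon expansion: `g` is the sum of its two restrictions to `x v = s`, each multiplied by the
indicator of `x v = s`. Target and borrowed wire exchange roles at each level, hence the quantifier
over `b` inside the induction. -/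
theorem exists_adds_of_dependsOn {V : Type} [DecidableEq V] (S : Finset V) :
    ∀ (b : Bool) (g : (V → Bool) → Bool),
      (∀ x y : V → Bool, (∀ v ∈ S, x v = y v) → g x = g y) →
      ∃ l : List (CGate (V ⊕ Bool)), Adds l b g := by
  induction S using Finset.induction_on with
  | empty =>
    intro b g hg
    refine ⟨[⟨Sum.inr b, Sum.inr !b, Sum.inr !b, fun _ _ => g fun _ => false⟩], ?_, fun x => ?_⟩
    · simp [Valid]
    · rw [hg (fun v => x (Sum.inl v)) (fun _ => false) (by simp)]
      rfl
  | insert v S hv ih =>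
    intro b g hg
    have hs : ∀ s : Bool, ∃ l : List (CGate (V ⊕ Bool)),
        Adds l b fun x => (x v == s) && g (Function.update x v s) := by
      intro s
      obtain ⟨l, hl⟩ := ih (!b) (fun x => g (Function.update x v s)) (by
        intro x y hxy
        refine hg _ _ fun u hu => ?_
        rcases Finset.mem_insert.1 hu with rfl | hu
        · simp
        · have : u ≠ v := fun e => hv (e ▸ hu)
          simp [this, hxy u hu])
      exact hl.exists_control v s
    obtain ⟨l₀, h₀⟩ := hs false
    obtain ⟨l₁, h₁⟩ := hs true
    refine ⟨l₀ ++ l₁, ?_⟩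
    convert h₀.append h₁ using 2 with x
    cases hx : x v
    · rw [← hx, Function.update_eq_self]; simp [hx]
    · rw [← hx, Function.update_eq_self]; simp [hx]

/-- Every Boolean function can be added to a wire with the help of one borrowed wire. -/
theorem exists_adds {V : Type} [Fintype V] [DecidableEq V] (g : (V → Bool) → Bool) :
    ∃ l : List (CGate (V ⊕ Bool)), Adds l false g :=
  exists_adds_of_dependsOn Finset.univ false g fun x y h => by
    rw [show x = y from funext fun v => h v (Finset.mem_univ v)]

end CGate

/-! ### From reversible circuits to networks -/

namespace CGate

variable {W : Type} [DecidableEq W]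

/-- The gates of `l` are valid and act on disjoint sets of wires. -/
def Parallel (l : List (CGate W)) : Prop :=
  (∀ g ∈ l, g.Valid) ∧ l.Pairwise fun g h => Disjoint g.wires h.wires

theorem Parallel.reverse {l : List (CGate W)} (h : Parallel l) : Parallel l.reverse :=
  ⟨fun g hg => h.1 g (List.mem_reverse.1 hg),
    List.pairwise_reverse.2 (h.2.imp fun hd => hd.symm)⟩

/-- Every gate expands into exactly five steps on its own wires, so the expansions are zipped into
five common layers. -/
theorem Parallel.exists_gates {L : List (CGate W)} (hL : Parallel L) :
    ∃ Ls : List (List (QGate W)), Ls.length = 5 ∧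
      (∀ l ∈ Ls, l.length ≤ L.length ∧ l.Pairwise (fun g h => Disjoint g.wires h.wires) ∧
        ∀ k ∈ l, ∃ g ∈ L, k.wires ⊆ g.wires) ∧
      ∀ ψ, QGate.applyList Ls.flatten ψ = fun x => ψ (run L.reverse x) := by
  induction L with
  | nil => exact ⟨List.replicate 5 [], rfl, by simp, fun ψ => rfl⟩
  | cons g L ih =>
    obtain ⟨hv, hp⟩ := hL
    rw [List.forall_mem_cons] at hv
    rw [List.pairwise_cons] at hp
    obtain ⟨Ls, hlen, hLs, hact⟩ := ih ⟨hv.2, hp.2⟩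
    obtain ⟨gs, hgs, hw, hg⟩ := hv.1.exists_gates
    have hd : ∀ k ∈ gs, ∀ l ∈ Ls, ∀ k' ∈ l, Disjoint k.wires k'.wires := by
      intro k hk l hl k' hk'
      obtain ⟨h, hh, hs⟩ := (hLs l hl).2.2 k' hk'
      exact Finset.disjoint_of_subset_left (hw k hk)
        (Finset.disjoint_of_subset_right hs (hp.1 h hh))
    refine ⟨List.zipWith List.cons gs Ls, by simp [hgs, hlen], fun l hl => ?_, fun ψ => ?_⟩
    · obtain ⟨i, hi, rfl⟩ := List.getElem_of_mem hl
      rw [List.length_zipWith, lt_min_iff] at hi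
      rw [List.getElem_zipWith]
      have hk := List.getElem_mem hi.1
      have hl := List.getElem_mem hi.2
      obtain ⟨h1, h2, h3⟩ := hLs _ hl
      refine ⟨by simpa using h1, List.pairwise_cons.2 ⟨hd _ hk _ hl, h2⟩, ?_⟩
      rw [List.forall_mem_cons]
      refine ⟨⟨g, List.mem_cons_self, hw _ hk⟩, fun k' hk' => ?_⟩
      obtain ⟨h, hh, hs⟩ := h3 k' hk'
      exact ⟨h, List.mem_cons_of_mem _ hh, hs⟩
    · rw [QGate.applyList_flatten_zipWith_cons gs Ls (by rw [hgs, hlen]) hd, hact, hg]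
      simp only [List.reverse_cons, run_append]
      rfl

/-- The reversal appears because a gate acts on amplitudes by precomposition: applying `g` and then
`h` sends `ψ` to `ψ ∘ g.act ∘ h.act`. -/
theorem exists_layers (Cs : List (List (CGate W))) (hC : ∀ l ∈ Cs, Parallel l) :
    ∃ Ls : List (QLayer W), Ls.length = 5 * Cs.length ∧
      (Ls.map fun l => l.gates.length).sum ≤ 5 * (Cs.map List.length).sum ∧
      ∀ ψ, Ls.foldl (fun φ l => l.apply φ) ψ = fun x => ψ (run Cs.flatten.reverse x) := by
  induction Cs with
  | nil => exact ⟨[], rfl, by simp, fun ψ => rfl⟩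
  | cons L Cs ih =>
    rw [List.forall_mem_cons] at hC
    obtain ⟨Ms, hMlen, hMsum, hM⟩ := ih hC.2
    obtain ⟨Ls, hlen, hLs, hact⟩ := hC.1.exists_gates
    obtain ⟨Ls', rfl⟩ : ∃ Ls' : List (QLayer W), Ls'.map QLayer.gates = Ls := by
      clear hlen hact
      induction Ls with
      | nil => exact ⟨[], rfl⟩
      | cons l Ls ih' =>
        rw [List.forall_mem_cons] at hLs
        obtain ⟨Ls', rfl⟩ := ih' hLs.2
        exact ⟨⟨l, hLs.1.2.1⟩ :: Ls', rfl⟩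
    have happ : ∀ (l : List (QLayer W)) ψ, l.foldl (fun φ l => l.apply φ) ψ =
        QGate.applyList (l.map QLayer.gates).flatten ψ := by
      intro l
      induction l with
      | nil => exact fun ψ => rfl
      | cons a l ih' =>
        intro ψ
        rw [List.foldl_cons, ih', List.map_cons, List.flatten_cons, QGate.applyList_append]
        rfl
    refine ⟨Ls' ++ Ms, ?_, ?_, fun ψ => ?_⟩
    · rw [List.length_map] at hlen
      rw [List.length_append, hlen, hMlen, List.length_cons]
      ring
    · rw [List.map_append, List.sum_append, List.map_cons, List.sum_cons, mul_add]
      refine add_le_add ?_ hMsum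
      refine (List.sum_le_card_nsmul _ L.length ?_).trans (le_of_eq ?_)
      · intro k hk
        obtain ⟨l, hl, rfl⟩ := List.mem_map.1 hk
        exact (hLs _ (List.mem_map_of_mem hl)).1
      · rw [List.length_map] at hlen ⊢
        rw [hlen, smul_eq_mul]
    · rw [List.foldl_append, hM, happ, hact]
      simp only [List.flatten_cons, List.reverse_append, run_append]

end CGate

theorem QNN.prob_withAnc {D : Type} [Fintype D] [DecidableEq D] (N : QNN D) (ψ : QState D) :
    (N.withAnc ψ).prob = ψ.prob := by
  unfold QState.prob
  rw [← (Equiv.sumArrowEquivProdArrow D (Fin N.anc) Bool).symm.sum_comp, Fintype.sum_prod_type]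
  refine Finset.sum_congr rfl fun d _ => ?_
  rw [Finset.sum_eq_single fun _ => false]
  · simp [QNN.withAnc, Equiv.sumArrowEquivProdArrow]
  · intro z _ hz
    have : ¬ ∀ k, z k = false := fun h => hz (funext h)
    simp [QNN.withAnc, Equiv.sumArrowEquivProdArrow, this]
  · simp

/-- A reversible circuit that computes a predicate gives a network that tests it. -/
theorem exists_qnn_of_circuit {D : Type} [Fintype D] [DecidableEq D] (a : ℕ)
    (Cs : List (List (CGate (QNNWire D a)))) (hC : ∀ l ∈ Cs, CGate.Parallel l)
    (hsink : ∀ l ∈ Cs, ∀ g ∈ l, none ∉ g.wires) (o : D ⊕ Fin a) (f : Bool → Bool)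
    (P : (D → Bool) → Prop)
    (hP : ∀ x : QNNWire D a → Bool, (∀ k, x (some (Sum.inr k)) = false) →
      (f (CGate.run Cs.flatten x (some o)) = true ↔ P fun d => x (some (Sum.inl d)))) :
    ∃ N : QNN D, N.depth = 5 * (2 * Cs.length + 1) + 1 ∧
      N.size ≤ 5 * (2 * (Cs.map List.length).sum + 1) + 1 ∧
      ∀ ψ : QState D, ψ.prob = 1 →
        ((∀ d, ψ d ≠ 0 → P d) → N.Passes ψ) ∧ ((∀ d, ψ d ≠ 0 → ¬ P d) → N.Sinks ψ) := by
  let out : CGate (QNNWire D a) := ⟨none, some o, some o, fun b _ => f b⟩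
  let T := Cs.flatten
  have hT : ∀ g ∈ T, g.Valid ∧ none ∉ g.wires := fun g hg => by
    obtain ⟨l, hl, hgl⟩ := List.mem_flatten.1 hg
    exact ⟨(hC l hl).1 g hgl, hsink l hl g hgl⟩
  -- Compute, output, uncompute is a palindrome, so the reversal coming from precomposition does not
  -- change it.
  have hflat : (Cs ++ [[out]] ++ (Cs.map List.reverse).reverse).flatten.reverse =
      T ++ [out] ++ T.reverse := by
    simp only [List.flatten_append, ← List.reverse_flatten, List.reverse_append,
      List.reverse_reverse, T]
    simp
  obtain ⟨Ls, hlen, hsum, hact⟩ := CGate.exists_layers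
    (Cs ++ [[out]] ++ (Cs.map List.reverse).reverse) (by
      simp only [List.mem_append, List.mem_reverse, List.mem_map, List.mem_singleton]
      rintro l ((hl | rfl) | ⟨l, hl, rfl⟩)
      · exact hC l hl
      · exact ⟨by simp [out, CGate.Valid], by simp⟩
      · exact (hC l hl).reverse)
  have hrun : ∀ x : QNNWire D a → Bool, CGate.run (T ++ [out] ++ T.reverse) x =
      Function.update x none (x none ^^ f (CGate.run T x (some o))) := by
    intro x
    rw [CGate.run_append, CGate.run_append]
    change CGate.run T.reverse (Function.update (CGate.run T x) none
      (CGate.run T x none ^^ f (CGate.run T x (some o)))) = _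
    rw [CGate.run_update _ _ fun g hg => (hT g (List.mem_reverse.1 hg)).2,
      CGate.run_reverse_run _ fun g hg => (hT g hg).1, CGate.run_of_forall_ne]
    intro g hg e
    exact (hT g hg).2 (by simp [CGate.wires, ← e])
  let N : QNN D := ⟨a, Ls⟩
  -- On the support of `ψ` the answer is constantly `b`, so the branch of outcome `b` carries the
  -- whole input state.
  have hbranch : ∀ (ψ : QState D) (b : Bool), (∀ d, ψ d ≠ 0 → (P d ↔ b = true)) →
      N.branch ψ b = N.withAnc ψ := by
    intro ψ b hb
    funext z
    change (Ls.foldl (fun φ l => l.apply φ) (N.source ψ)) _ = _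
    rw [hact, hflat]
    beta_reduce
    rw [hrun, QNN.source]
    simp only [Function.update_self, ne_eq, reduceCtorEq, not_false_eq_true, Function.update_of_ne,
      Option.elim_none, Option.elim_some]
    by_cases hz : N.withAnc ψ z = 0
    · rw [hz, ite_self]
    · have hk : ∀ k, z (Sum.inr k) = false := by
        by_contra h
        exact hz (if_neg h)
      have hψ : ψ (fun d => z (Sum.inl d)) ≠ 0 := fun h => hz (by rw [QNN.withAnc, if_pos hk, h])
      rw [if_pos]
      have := (hP (fun y => y.elim b z) hk).trans (hb _ hψ)
      rw [Bool.eq_iff_iff.2 this, Bool.xor_self]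
  refine ⟨N, ?_, ?_, fun ψ hψ => ⟨fun h => ?_, fun h => ?_⟩⟩
  · simp only [QNN.depth, N, hlen, List.length_append, List.length_reverse, List.length_map,
      List.length_singleton]
    ring
  · refine Nat.succ_le_succ (hsum.trans (le_of_eq ?_))
    simp only [List.map_append, List.sum_append, List.map_reverse, List.sum_reverse, List.map_map,
      List.map_cons, List.map_nil, List.sum_cons, List.sum_nil, List.length_singleton]
    have : List.length ∘ List.reverse = (List.length : List (CGate (QNNWire D a)) → ℕ) :=
      funext fun l => List.length_reverse
    rw [this]
    ring
  · have := hbranch ψ true fun d hd => by simp [h d hd]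
    exact ⟨by rw [this, N.prob_withAnc, hψ], this⟩
  · have := hbranch ψ false fun d hd => by simp [h d hd]
    change (N.branch ψ false).prob = 1
    rw [this, N.prob_withAnc, hψ]

/-! ### The counting circuit -/

namespace CGate

/-- The gate sequence `P`, carried out simultaneously on the wires `e c`, `c < M`. -/
def family {X W : Type} (e : ℕ → X → W) (M : ℕ) (P : List (CGate X)) : List (List (CGate W)) :=
  P.map fun g => (List.range M).map fun c => g.map (e c)

variable {X W : Type} [DecidableEq W]

theorem wires_map [DecidableEq X] (e : X → W) (g : CGate X) : (g.map e).wires = g.wires.image e := by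
  simp [wires, map, Finset.image_insert]

theorem parallel_map_range {N : ℕ} {g : ℕ → CGate W} (hv : ∀ i < N, (g i).Valid)
    (hd : ∀ i < N, ∀ j < N, ∀ w ∈ (g i).wires, w ∈ (g j).wires → i = j) :
    Parallel ((List.range N).map g) := by
  constructor
  · simpa using hv
  · rw [List.pairwise_map]
    refine List.nodup_range.pairwise_of_forall_ne fun i hi j hj hij => ?_
    rw [List.mem_range] at hi hj
    exact Finset.disjoint_left.2 fun w hw hw' => hij (hd i hi j hj w hw hw')

theorem run_map_range {N : ℕ} {g : ℕ → CGate W} (h : Parallel ((List.range N).map g)) {i : ℕ}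
    (hi : i < N) (y : W → Bool) : run ((List.range N).map g) y (g i).tgt =
      (y (g i).tgt ^^ (g i).fn (y (g i).fst) (y (g i).snd)) :=
  run_tgt _ h.2 _ (List.mem_map_of_mem (List.mem_range.2 hi)) y

theorem run_map_range_of_ne {N : ℕ} {g : ℕ → CGate W} {w : W} (h : ∀ i < N, w ≠ (g i).tgt)
    (y : W → Bool) : run ((List.range N).map g) y w = y w :=
  run_of_forall_ne _ _ (by simpa using h) y

theorem parallel_family [DecidableEq X] {e : ℕ → X → W} {M : ℕ}
    (he : ∀ c < M, ∀ c' < M, ∀ x x', e c x = e c' x' → c = c' ∧ x = x') {P : List (CGate X)}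
    (hP : ∀ g ∈ P, g.Valid) : ∀ l ∈ family e M P, Parallel l := by
  simp only [family, List.mem_map]
  rintro _ ⟨g, hg, rfl⟩
  refine parallel_map_range (fun c hc => ?_) fun c hc c' hc' w hw hw' => ?_
  · exact ⟨fun h => (hP g hg).1 (he c hc c hc _ _ h).2, fun h => (hP g hg).2 (he c hc c hc _ _ h).2⟩
  · rw [wires_map, Finset.mem_image] at hw hw'
    obtain ⟨x, -, rfl⟩ := hw
    obtain ⟨x', -, hx⟩ := hw'
    exact (he c' hc' c hc _ _ hx).1.symm

/-- Distinct cells use disjoint wires, so each copy of the program runs as if it were alone. -/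
theorem run_family [DecidableEq X] {e : ℕ → X → W} {M : ℕ}
    (he : ∀ c < M, ∀ c' < M, ∀ x x', e c x = e c' x' → c = c' ∧ x = x') {P : List (CGate X)}
    (hP : ∀ g ∈ P, g.Valid) {c : ℕ} (hc : c < M) (y : W → Bool) (x : X) :
    run (family e M P).flatten y (e c x) = run P (fun x => y (e c x)) x := by
  induction P generalizing y with
  | nil => rfl
  | cons g P ih =>
    have hl := parallel_family he hP _ (List.mem_cons_self : _ ∈ family e M (g :: P))
    rw [List.forall_mem_cons] at hP
    change run ((List.range M).map (fun c => g.map (e c)) ++ (family e M P).flatten) y _ = _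
    rw [run_append, ih hP.2, run_cons]
    congr 1
    funext x'
    rw [act]
    by_cases hx : x' = g.tgt
    · subst hx
      rw [Function.update_self]
      exact run_map_range hl hc y
    · rw [Function.update_of_ne hx]
      exact run_map_range_of_ne (fun i hi h => hx (he c hc i hi _ _ h).2) y

theorem run_family_of_ne {e : ℕ → X → W} {M : ℕ} {P : List (CGate X)} {w : W}
    (hw : ∀ c < M, ∀ x, w ≠ e c x) (y : W → Bool) : run (family e M P).flatten y w = y w := by
  refine run_of_forall_ne _ _ (fun g hg => ?_) y
  simp only [family, List.mem_flatten, List.mem_map] at hg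
  obtain ⟨_, ⟨k, -, rfl⟩, hg⟩ := hg
  obtain ⟨c, hc, rfl⟩ := List.mem_map.1 hg
  exact hw c (List.mem_range.1 hc) _

end CGate

/-- Wires for `M` cells of data `V` and for `L + 1` columns of `N` pairs of auxiliary bits. -/
structure Wiring (V W : Type) (M L N : ℕ) : Type where
  dat : ℕ → V → W
  anc : ℕ → ℕ → Bool → W
  dat_inj : ∀ c < M, ∀ c' < M, ∀ v v', dat c v = dat c' v' → c = c' ∧ v = v'
  anc_inj : ∀ k ≤ L, ∀ i < N, ∀ k' ≤ L, ∀ i' < N, ∀ b b', anc k i b = anc k' i' b' →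
    k = k' ∧ i = i' ∧ b = b'
  dat_ne_anc : ∀ c v k i b, dat c v ≠ anc k i b

namespace Wiring

open CGate

variable {V W : Type} {M L N : ℕ}

/-- The wires of cell `c` together with the pair of bits `c * B + t` of the first column. -/
def cell (ω : Wiring V W M L N) (B t c : ℕ) : V ⊕ Bool → W :=
  Sum.elim (ω.dat c) fun b => ω.anc 0 (c * B + t) b

/-- The layers that compute the bits of index `t < B'` of all cells. -/
def inputLayers (ω : Wiring V W M L N) (P : ℕ → List (CGate (V ⊕ Bool))) (B B' : ℕ) :
    List (List (CGate W)) :=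
  (List.range B').flatMap fun t => family (ω.cell B t) M (P t)

/-- The layer that copies column `k`. -/
def copyLayer (ω : Wiring V W M L N) (k : ℕ) : List (CGate W) :=
  (List.range N).map fun i => ⟨ω.anc k i true, ω.anc k i false, ω.anc k i false, fun a _ => a⟩

/-- The layer that computes column `k + 1` from column `k` and its copy. -/
def evalLayer (ω : Wiring V W M L N) (k : ℕ) (s : SortColumn) : List (CGate W) :=
  (List.range N).map fun i =>
    ⟨ω.anc (k + 1) i false, ω.anc k (s.src i) false, ω.anc k (s.aux i) true, s.fn i⟩

/-- The layers that evaluate a sorting network, starting from column `k`. -/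
def sortLayers (ω : Wiring V W M L N) : ℕ → List SortColumn → List (List (CGate W))
  | _, [] => []
  | k, s :: l => ω.copyLayer k :: ω.evalLayer k s :: sortLayers ω (k + 1) l

theorem length_sortLayers (ω : Wiring V W M L N) (k : ℕ) (l : List SortColumn) :
    (ω.sortLayers k l).length = 2 * l.length := by
  induction l generalizing k with
  | nil => rfl
  | cons s l ih => simp only [sortLayers, List.length_cons, ih]; ring

theorem cell_inj (ω : Wiring V W M L N) {B t : ℕ} (ht : t < B) (hN : M * B ≤ N) :
    ∀ c < M, ∀ c' < M, ∀ x x', ω.cell B t c x = ω.cell B t c' x' → c = c' ∧ x = x' := by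
  have hlt : ∀ c < M, c * B + t < N := fun c hc => by
    have : (c + 1) * B ≤ M * B := Nat.mul_le_mul_right B hc
    rw [add_mul] at this
    omega
  rintro c hc c' hc' (v | b) (v' | b') h
  · obtain ⟨h1, h2⟩ := ω.dat_inj c hc c' hc' v v' h
    exact ⟨h1, congrArg _ h2⟩
  · exact (ω.dat_ne_anc _ _ _ _ _ h).elim
  · exact (ω.dat_ne_anc _ _ _ _ _ h.symm).elim
  · obtain ⟨-, h1, h2⟩ := ω.anc_inj 0 (Nat.zero_le _) _ (hlt c hc) 0 (Nat.zero_le _) _ (hlt c' hc') b b' h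
    exact ⟨Nat.eq_of_mul_eq_mul_right (by omega) (Nat.add_right_cancel h1), congrArg _ h2⟩

theorem parallel_copyLayer [DecidableEq W] (ω : Wiring V W M L N) {k : ℕ} (hk : k ≤ L) :
    Parallel (ω.copyLayer k) := by
  refine parallel_map_range (fun i hi => ?_) fun i hi j hj w hw hw' => ?_
  · exact ⟨fun h => by simpa using (ω.anc_inj k hk i hi k hk i hi _ _ h).2.2,
      fun h => by simpa using (ω.anc_inj k hk i hi k hk i hi _ _ h).2.2⟩
  · have : ∀ i, ∀ w ∈ ({ω.anc k i true, ω.anc k i false, ω.anc k i false} : Finset W),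
        ∃ b, w = ω.anc k i b := by
      simp only [Finset.mem_insert, Finset.mem_singleton]
      rintro i w (h | h | h) <;> exact ⟨_, h⟩
    obtain ⟨b, rfl⟩ := this i w hw
    obtain ⟨b', h⟩ := this j _ hw'
    exact (ω.anc_inj k hk i hi k hk j hj _ _ h).2.1

/-- A bit may serve as `src` of one output and as `aux` of another. Reading `src` from the column
and `aux` from its copy, both injectively, and writing to a fresh column keeps the gates disjoint.
-/
theorem parallel_evalLayer [DecidableEq W] (ω : Wiring V W M L N) {k : ℕ} (hk : k + 1 ≤ L)
    {s : SortColumn} (hs : s.Valid N) : Parallel (ω.evalLayer k s) := by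
  have hk' : k ≤ L := by omega
  refine parallel_map_range (fun i hi => ?_) fun i hi j hj w hw hw' => ?_
  · constructor <;> intro h
    · have := (ω.anc_inj k hk' _ (hs.src_lt i hi) (k + 1) hk i hi _ _ h).1
      omega
    · have := (ω.anc_inj k hk' _ (hs.aux_lt i hi) (k + 1) hk i hi _ _ h).1
      omega
  · simp only [wires, Finset.mem_insert, Finset.mem_singleton] at hw hw'
    rcases hw with rfl | rfl | rfl <;> rcases hw' with h | h | h
    · exact (ω.anc_inj _ hk i hi _ hk j hj _ _ h).2.1
    · have := (ω.anc_inj _ hk i hi _ hk' _ (hs.src_lt j hj) _ _ h).1; omega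
    · have := (ω.anc_inj _ hk i hi _ hk' _ (hs.aux_lt j hj) _ _ h).1; omega
    · have := (ω.anc_inj _ hk' _ (hs.src_lt i hi) _ hk j hj _ _ h).1; omega
    · exact hs.src_inj i hi j hj
        (ω.anc_inj _ hk' _ (hs.src_lt i hi) _ hk' _ (hs.src_lt j hj) _ _ h).2.1
    · simpa using (ω.anc_inj _ hk' _ (hs.src_lt i hi) _ hk' _ (hs.aux_lt j hj) _ _ h).2.2
    · have := (ω.anc_inj _ hk' _ (hs.aux_lt i hi) _ hk j hj _ _ h).1; omega
    · simpa using (ω.anc_inj _ hk' _ (hs.aux_lt i hi) _ hk' _ (hs.src_lt j hj) _ _ h).2.2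
    · exact hs.aux_inj i hi j hj
        (ω.anc_inj _ hk' _ (hs.aux_lt i hi) _ hk' _ (hs.aux_lt j hj) _ _ h).2.1

theorem parallel_sortLayers [DecidableEq W] (ω : Wiring V W M L N) (l : List SortColumn)
    (hl : ∀ s ∈ l, s.Valid N) (k : ℕ) (hk : k + l.length ≤ L) :
    ∀ g ∈ ω.sortLayers k l, Parallel g := by
  induction l generalizing k with
  | nil => simp [sortLayers]
  | cons s l ih =>
    rw [List.forall_mem_cons] at hl
    rw [List.length_cons] at hk
    rw [sortLayers, List.forall_mem_cons, List.forall_mem_cons]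
    exact ⟨ω.parallel_copyLayer (by omega), ω.parallel_evalLayer (by omega) hl.1,
      ih hl.2 (k + 1) (by omega)⟩

/-- The invariant `hy` says that the copy of column `k` and all later columns are still zero, so
adding a value to such a wire writes it. -/
theorem run_sortLayers [DecidableEq W] (ω : Wiring V W M L N) (l : List SortColumn)
    (hl : ∀ s ∈ l, s.Valid N) (k : ℕ) (hk : k + l.length ≤ L) (v : ℕ → Bool) (y : W → Bool)
    (hv : ∀ i < N, y (ω.anc k i false) = v i)
    (hy : ∀ k' ≤ L, ∀ i < N, ∀ b, k < k' ∨ k = k' ∧ b = true → y (ω.anc k' i b) = false) :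
    ∀ i < N, run (ω.sortLayers k l).flatten y (ω.anc (k + l.length) i false) =
      SortColumn.evalList l v i := by
  induction l generalizing k v y with
  | nil => exact hv
  | cons s l ih =>
    rw [List.forall_mem_cons] at hl
    rw [List.length_cons] at hk
    have hk₀ : k ≤ L := by omega
    have hk₁ : k + 1 ≤ L := by omega
    intro i hi
    rw [sortLayers, List.flatten_cons, List.flatten_cons, run_append, run_append,
      List.length_cons, show k + (l.length + 1) = k + 1 + l.length by ring]
    set y₁ := run (ω.copyLayer k) y with hy₁
    have h₁f : ∀ k' ≤ L, ∀ i < N, ∀ b, k ≠ k' ∨ b = false →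
        y₁ (ω.anc k' i b) = y (ω.anc k' i b) := by
      intro k' hk' i hi b h
      refine run_map_range_of_ne (fun j hj e => ?_) y
      obtain ⟨rfl, -, rfl⟩ := ω.anc_inj k' hk' i hi k hk₀ j hj _ _ e
      simp at h
    have h₁t : ∀ i < N, y₁ (ω.anc k i true) = v i := by
      intro i hi
      rw [hy₁, copyLayer, run_map_range (ω.parallel_copyLayer hk₀) hi y]
      simp only
      rw [hv i hi, hy k hk₀ i hi true (Or.inr ⟨rfl, rfl⟩), Bool.false_xor]
    refine ih hl.2 (k + 1) (by omega) (s.eval v) _ (fun j hj => ?_)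
      (fun k' hk' j hj b h => ?_) i hi
    · rw [evalLayer, run_map_range (ω.parallel_evalLayer hk₁ hl.1) hj y₁]
      simp only
      rw [h₁f _ hk₁ j hj _ (Or.inr rfl), hy _ hk₁ j hj _ (Or.inl (by omega)),
        h₁f _ hk₀ _ (hl.1.src_lt j hj) _ (Or.inr rfl), hv _ (hl.1.src_lt j hj),
        h₁t _ (hl.1.aux_lt j hj), Bool.false_xor]
      rfl
    · rw [evalLayer, run_map_range_of_ne, h₁f k' hk' j hj b (Or.inl (by omega))]
      · exact hy k' hk' j hj b (Or.inl (by omega))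
      · intro j' hj' e
        obtain ⟨rfl, -, rfl⟩ := ω.anc_inj k' hk' j hj (k + 1) hk₁ j' hj' _ _ e
        simp at h

/-- Bit `t` of cell `c` is wire `c * B + t` of column `0`, and its partner `true` is the borrowed
wire, returned clean. Different `t` are handled one after another because they read the same data.
-/
theorem run_inputLayers [DecidableEq V] [DecidableEq W] (ω : Wiring V W M L N) {B : ℕ}
    (hN : M * B ≤ N) (F : (V → Bool) → ℕ) (P : ℕ → List (CGate (V ⊕ Bool)))
    (hP : ∀ t, Adds (P t) false fun v => decide (t < F v)) (y : W → Bool)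
    (hy : ∀ k i b, y (ω.anc k i b) = false) (B' : ℕ) (hB' : B' ≤ B) :
    (∀ c < M, ∀ v, run (ω.inputLayers P B B').flatten y (ω.dat c v) = y (ω.dat c v)) ∧
    ∀ k ≤ L, ∀ i < N, ∀ b, run (ω.inputLayers P B B').flatten y (ω.anc k i b) =
      decide (k = 0 ∧ b = false ∧ i / B < M ∧ i % B < B' ∧
        i % B < F fun v => y (ω.dat (i / B) v)) := by
  induction B' with
  | zero => exact ⟨fun c hc v => rfl, fun k hk i hi b => by simp [inputLayers, run, hy]⟩
  | succ t ih =>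
    obtain ⟨ih₁, ih₂⟩ := ih (by omega)
    have hinj := ω.cell_inj (show t < B by omega) hN
    have hsplit : (ω.inputLayers P B (t + 1)).flatten =
        (ω.inputLayers P B t).flatten ++ (family (ω.cell B t) M (P t)).flatten := by
      simp [inputLayers, List.range_succ]
    rw [hsplit]
    simp only [run_append]
    set y' := run (ω.inputLayers P B t).flatten y
    have hcell : ∀ c < M, ∀ x, run (family (ω.cell B t) M (P t)).flatten y' (ω.cell B t c x) = _ :=
      fun c hc x => (run_family hinj (hP t).1 hc y' x).trans (congrFun ((hP t).2 _) x)
    refine ⟨fun c hc v => ?_, fun k hk i hi b => ?_⟩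
    · refine (hcell c hc (Sum.inl v)).trans ?_
      rw [Function.update_of_ne (by simp)]
      exact ih₁ c hc v
    · by_cases h : k = 0 ∧ i / B < M ∧ i % B = t
      · obtain ⟨rfl, hc, rfl⟩ := h
        have hi' : i / B * B + i % B = i := Nat.div_add_mod' i B
        have := hcell (i / B) hc (Sum.inr b)
        simp only [cell, Sum.elim_inr, Sum.elim_inl, hi'] at this
        rw [this]
        cases b
        · rw [Function.update_self, ih₂ 0 hk i hi]
          simp [hc, ih₁ _ hc]
        · rw [Function.update_of_ne (by simp)]
          simp only [Sum.elim_inr]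
          rw [ih₂ 0 hk i hi]
          simp
      · rw [run_family_of_ne, ih₂ k hk i hi]
        · congr 1
          apply propext
          constructor
          · rintro ⟨h1, h2, h3, h4, h5⟩
            exact ⟨h1, h2, h3, by omega, h5⟩
          · rintro ⟨h1, h2, h3, h4, h5⟩
            exact ⟨h1, h2, h3, by omega, h5⟩
        · rintro c hc (v | b') e
          · exact ω.dat_ne_anc _ _ _ _ _ e.symm
          · have hlt : (c + 1) * B ≤ M * B := Nat.mul_le_mul_right B hc
            rw [add_mul] at hlt
            obtain ⟨rfl, rfl, -⟩ := ω.anc_inj k hk i hi 0 (Nat.zero_le _) (c * B + t) (by omega) _ _ e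
            refine h ⟨rfl, ?_, ?_⟩
            · rwa [mul_comm, Nat.mul_add_div (by omega), Nat.div_eq_of_lt (by omega), add_zero]
            · rw [mul_comm, Nat.mul_add_mod, Nat.mod_eq_of_lt (by omega)]

theorem sum_range_digits (M B : ℕ) (f : ℕ → ℕ → ℕ) :
    ∑ i ∈ Finset.range (M * B), f (i / B) (i % B) =
      ∑ c ∈ Finset.range M, ∑ t ∈ Finset.range B, f c t := by
  induction M with
  | zero => simp
  | succ M ih =>
    rw [add_mul, one_mul, Finset.sum_range_add, ih, Finset.sum_range_succ]
    congr 1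
    refine Finset.sum_congr rfl fun t ht => ?_
    rw [Finset.mem_range] at ht
    rw [mul_comm, Nat.mul_add_div (by omega), Nat.div_eq_of_lt ht, add_zero, Nat.mul_add_mod,
      Nat.mod_eq_of_lt ht]

/-- Positions from `M * B` on are padding up to the power of two and contribute zero. -/
theorem sum_unary {M B N : ℕ} (hB : 0 < B) (hN : M * B ≤ N) (F : ℕ → ℕ) (hF : ∀ c, F c ≤ B) :
    ∑ i ∈ Finset.range N, (decide (i / B < M ∧ i % B < F (i / B))).toNat =
      ∑ c ∈ Finset.range M, F c := by
  rw [← Finset.sum_subset (Finset.range_subset_range.2 hN),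
    sum_range_digits M B fun c t => (decide (c < M ∧ t < F c)).toNat]
  · refine Finset.sum_congr rfl fun c hc => ?_
    rw [Finset.mem_range] at hc
    simp only [hc, true_and, Bool.toNat, Bool.cond_decide]
    rw [← Finset.card_filter]
    have : (Finset.range B).filter (fun t => t < F c) = Finset.range (F c) := by
      ext t
      have := hF c
      simp only [Finset.mem_filter, Finset.mem_range]
      omega
    rw [this, Finset.card_range]
  · intro i _ hi
    rw [Finset.mem_range, ← Nat.div_lt_iff_lt_mul hB] at hi
    simp [hi]

/-- The circuit that writes the sum of the values `F` of all cells in unary. -/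
theorem exists_count [DecidableEq V] [DecidableEq W] (p B : ℕ) (hB : 0 < B) (hM : M * B ≤ 2 ^ p)
    (ω : Wiring V W M (SortColumn.sort p).length (2 ^ p)) (F : (V → Bool) → ℕ) (hF : ∀ v, F v ≤ B)
    (P : ℕ → List (CGate (V ⊕ Bool))) (hP : ∀ t, Adds (P t) false fun v => decide (t < F v)) :
    ∃ Cs : List (List (CGate W)), (∀ l ∈ Cs, Parallel l) ∧
      (∀ l ∈ Cs, ∀ g ∈ l, ∀ w ∈ g.wires, (∃ c v, w = ω.dat c v) ∨ ∃ k i b, w = ω.anc k i b) ∧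
      Cs.length ≤ (∑ t ∈ Finset.range B, (P t).length) + 2 * p ^ 2 ∧
      (∀ l ∈ Cs, l.length ≤ 2 ^ p) ∧
      ∀ y : W → Bool, (∀ k i b, y (ω.anc k i b) = false) → ∀ i < 2 ^ p,
        run Cs.flatten y (ω.anc (SortColumn.sort p).length i false) =
          decide (i < ∑ c ∈ Finset.range M, F fun v => y (ω.dat c v)) := by
  have hcases : ∀ l ∈ ω.inputLayers P B B ++ ω.sortLayers 0 (SortColumn.sort p), ∀ Q : List (CGate W) → Prop,
      (∀ t < B, ∀ l ∈ family (ω.cell B t) M (P t), Q l) → (∀ k, Q (ω.copyLayer k)) →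
        (∀ k, ∀ s, Q (ω.evalLayer k s)) → Q l := by
    intro l hl Q h₁ h₂ h₃
    rcases List.mem_append.1 hl with hl | hl
    · simp only [inputLayers, List.mem_flatMap, List.mem_range] at hl
      obtain ⟨t, ht, hl⟩ := hl
      exact h₁ t ht l hl
    · have : ∀ S k, ∀ l ∈ ω.sortLayers k S, Q l := by
        intro S
        induction S with
        | nil => simp [sortLayers]
        | cons s S ih =>
          intro k
          rw [sortLayers, List.forall_mem_cons, List.forall_mem_cons]
          exact ⟨h₂ k, h₃ k s, ih _⟩
      exact this _ 0 l hl
  refine ⟨ω.inputLayers P B B ++ ω.sortLayers 0 (SortColumn.sort p), ?_, ?_, ?_, ?_, ?_⟩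
  · intro l hl
    rcases List.mem_append.1 hl with hl | hl
    · simp only [inputLayers, List.mem_flatMap, List.mem_range] at hl
      obtain ⟨t, ht, hl⟩ := hl
      exact parallel_family (ω.cell_inj ht hM) (hP t).1 l hl
    · exact ω.parallel_sortLayers _ (SortColumn.sort_valid p) 0 (by omega) l hl
  · intro l hl
    refine hcases l hl (fun l => ∀ g ∈ l, ∀ w ∈ g.wires,
      (∃ c v, w = ω.dat c v) ∨ ∃ k i b, w = ω.anc k i b) ?_ ?_ ?_
    · simp only [family, List.mem_map]
      rintro t ht _ ⟨g, hg, rfl⟩ g' hg' w hw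
      obtain ⟨c, hc, rfl⟩ := List.mem_map.1 hg'
      rw [wires_map, Finset.mem_image] at hw
      obtain ⟨x | b, -, rfl⟩ := hw
      exacts [Or.inl ⟨_, _, rfl⟩, Or.inr ⟨_, _, _, rfl⟩]
    · intro k g hg w hw
      obtain ⟨i, hi, rfl⟩ := List.mem_map.1 hg
      simp only [wires, Finset.mem_insert, Finset.mem_singleton] at hw
      rcases hw with rfl | rfl | rfl <;> exact Or.inr ⟨_, _, _, rfl⟩
    · intro k s g hg w hw
      obtain ⟨i, hi, rfl⟩ := List.mem_map.1 hg
      simp only [wires, Finset.mem_insert, Finset.mem_singleton] at hw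
      rcases hw with rfl | rfl | rfl <;> exact Or.inr ⟨_, _, _, rfl⟩
  · rw [List.length_append, length_sortLayers]
    refine add_le_add (le_of_eq ?_) (Nat.mul_le_mul_left 2 (SortColumn.length_sort_le p))
    have : ∀ n, (ω.inputLayers P B n).length = ∑ t ∈ Finset.range n, (P t).length := by
      intro n
      induction n with
      | zero => rfl
      | succ n ih =>
        rw [Finset.sum_range_succ, ← ih]
        simp [inputLayers, List.range_succ, family]
    exact this B
  · intro l hl
    refine hcases l hl (fun l => l.length ≤ 2 ^ p) ?_ ?_ ?_
    · simp only [family, List.mem_map]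
      rintro t ht _ ⟨g, hg, rfl⟩
      rw [List.length_map, List.length_range]
      exact (Nat.le_mul_of_pos_right M hB).trans hM
    · simp [copyLayer]
    · simp [evalLayer]
  · intro y hy i hi
    obtain ⟨-, h⟩ := ω.run_inputLayers hM F P hP y hy B le_rfl
    have hv : ∀ i < 2 ^ p, run (ω.inputLayers P B B).flatten y (ω.anc 0 i false) =
        decide (i / B < M ∧ i % B < F fun v => y (ω.dat (i / B) v)) := by
      intro i hi
      rw [h 0 (Nat.zero_le _) i hi]
      congr 1
      simp [Nat.mod_lt _ hB]
    rw [List.flatten_append, run_append]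
    have := ω.run_sortLayers _ (SortColumn.sort_valid p) 0 (by omega) _ _ hv
      (fun k hk i hi b hkb => by
        rw [h k hk i hi b, decide_eq_false]
        rintro ⟨rfl, rfl, -⟩
        simp at hkb) i hi
    rw [zero_add] at this
    rw [this, SortColumn.evalList_sort p _ i hi,
      sum_unary hB hM (fun c => F fun v => y (ω.dat c v)) fun c => hF _]

end Wiring

/-! ### The chi-squared statistic in integers -/

/-- The natural number with binary digits `v`. -/
def binaryValue {w : ℕ} (v : Fin w → Bool) : ℕ :=
  ∑ t : Fin w, if v t then 2 ^ (t : ℕ) else 0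

theorem fixedPoint_eq {w : ℕ} (q : ℕ) (v : Fin w → Bool) :
    fixedPoint q v = binaryValue v / 2 ^ q := by
  simp [fixedPoint, binaryValue]

theorem binaryValue_le {w : ℕ} (v : Fin w → Bool) : binaryValue v ≤ 2 ^ w := by
  have h : binaryValue v ≤ ∑ t : Fin w, 2 ^ (t : ℕ) :=
    Finset.sum_le_sum fun t _ => by split <;> simp
  rw [Fin.sum_univ_eq_sum_range (fun t => 2 ^ t) w] at h
  exact h.trans (Nat.geomSum_lt le_rfl fun k hk => Finset.mem_range.1 hk).le

/-- The contribution of one cell to the statistic, multiplied by `(2 ^ w)! * 2 ^ q`. -/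
def cellValue (w : ℕ) (v : Fin w ⊕ Fin w → Bool) : ℕ :=
  (2 ^ w).factorial / binaryValue (fun t => v (Sum.inr t)) *
    ((binaryValue (fun t => v (Sum.inl t)) : ℤ) - binaryValue (fun t => v (Sum.inr t))).natAbs ^ 2

/-- Positivity of the expected value gives `1 ≤ k ≤ 2 ^ w`, so the natural-number division of the
factorial by `k` is exact. -/
theorem cast_cellValue {w : ℕ} (q : ℕ) (v : Fin w ⊕ Fin w → Bool)
    (h : 0 < fixedPoint q fun t => v (Sum.inr t)) :
    (cellValue w v : ℝ) =
      (fixedPoint q (fun t => v (Sum.inl t)) - fixedPoint q fun t => v (Sum.inr t)) ^ 2 /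
        fixedPoint q (fun t => v (Sum.inr t)) * ((2 ^ w).factorial * 2 ^ q) := by
  rw [fixedPoint_eq] at h ⊢
  rw [fixedPoint_eq, cellValue]
  have hle := binaryValue_le fun t => v (Sum.inr t)
  set k := binaryValue fun t => v (Sum.inr t)
  set l := binaryValue fun t => v (Sum.inl t)
  have hk : (k : ℝ) ≠ 0 := fun e => by simp [e] at h
  have hk0 : 0 < k := Nat.pos_of_ne_zero fun e => hk (by simp [e])
  rw [Nat.cast_mul, Nat.cast_div (Nat.dvd_factorial hk0 hle) hk, Nat.cast_pow, Nat.cast_natAbs,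
    Int.cast_abs, sq_abs]
  push_cast
  field_simp

/-- The wires of cell `c` of a table. -/
def tableWire (n r w : ℕ) [NeZero (n * r)] (c : ℕ) : Fin w ⊕ Fin w → TableQubit n r w :=
  Sum.map (fun t => ((finProdFinEquiv.symm (Fin.ofNat (n * r) c)).1,
      (finProdFinEquiv.symm (Fin.ofNat (n * r) c)).2, t))
    (fun t => ((finProdFinEquiv.symm (Fin.ofNat (n * r) c)).1,
      (finProdFinEquiv.symm (Fin.ofNat (n * r) c)).2, t))

theorem tableWire_inj {n r w : ℕ} [NeZero (n * r)] : ∀ c < n * r, ∀ c' < n * r, ∀ v v',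
    tableWire n r w c v = tableWire n r w c' v' → c = c' ∧ v = v' := by
  intro c hc c' hc' v v' h
  have key : (finProdFinEquiv.symm (Fin.ofNat (n * r) c) : Fin n × Fin r) =
      finProdFinEquiv.symm (Fin.ofNat (n * r) c') → c = c' := by
    intro e
    have := congrArg Fin.val (finProdFinEquiv.symm.injective e)
    simpa [Fin.ofNat, Nat.mod_eq_of_lt hc, Nat.mod_eq_of_lt hc'] using this
  rcases v with t | t <;> rcases v' with t' | t' <;>
    simp only [tableWire, Sum.map_inl, Sum.map_inr, Sum.inl.injEq, Sum.inr.injEq, Prod.mk.injEq,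
      reduceCtorEq] at h
  · exact ⟨key (Prod.ext h.1 h.2.1), by rw [h.2.2]⟩
  · exact ⟨key (Prod.ext h.1 h.2.1), by rw [h.2.2]⟩

theorem testHolds_iff {n r w : ℕ} [NeZero (n * r)] (q : ℕ) (α : ℝ) (d : TableQubit n r w → Bool)
    (hd : ∀ i j, 0 < expected q d i j) :
    TestHolds q α d ↔
      ∑ c ∈ Finset.range (n * r), cellValue w (fun v => d (tableWire n r w c v)) <
        ⌈chiSquaredCritical (degreesOfFreedom n r) α * ((2 ^ w).factorial * 2 ^ q)⌉₊ := by
  have hpos : (0 : ℝ) < (2 ^ w).factorial * 2 ^ q := by positivity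
  rw [Nat.lt_ceil, TestHolds, ← mul_lt_mul_iff_left₀ hpos, chiSquaredStat]
  suffices h : (∑ i, ∑ j, (observed q d i j - expected q d i j) ^ 2 / expected q d i j) *
      ((2 ^ w).factorial * 2 ^ q) =
        ((∑ c ∈ Finset.range (n * r), cellValue w fun v => d (tableWire n r w c v) : ℕ) : ℝ) by
    rw [h]
  rw [Finset.sum_range, ← finProdFinEquiv.sum_comp, Fintype.sum_prod_type, Nat.cast_sum,
    Finset.sum_mul]
  refine Finset.sum_congr rfl fun i _ => ?_
  rw [Nat.cast_sum, Finset.sum_mul]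
  refine Finset.sum_congr rfl fun j _ => ?_
  have hc : (finProdFinEquiv.symm (Fin.ofNat (n * r) (finProdFinEquiv (i, j) : Fin (n * r))) :
      Fin n × Fin r) = (i, j) := by
    rw [Fin.ofNat_val_eq_self, Equiv.symm_apply_apply]
  have h := cast_cellValue q
    (fun v => d (tableWire n r w (finProdFinEquiv (i, j) : Fin (n * r)) v))
  simp only [tableWire, Sum.map_inl, Sum.map_inr, hc] at h
  simp only [tableWire, hc]
  exact (h (hd i j)).symm

/-! ### The network -/

/-- The wires of the counting circuit as wires of a network. -/
def tableWiring (n r w : ℕ) [NeZero (n * r)] (L N : ℕ) [NeZero (2 * (N * (L + 1)))] :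
    Wiring (Fin w ⊕ Fin w) (QNNWire (TableQubit n r w) (2 * (N * (L + 1)))) (n * r) L N where
  dat c v := some (Sum.inl (tableWire n r w c v))
  anc k i b := some (Sum.inr (Fin.ofNat _ (2 * (k * N + i) + b.toNat)))
  dat_inj c hc c' hc' v v' h :=
    tableWire_inj c hc c' hc' v v' (Sum.inl_injective (Option.some_injective _ h))
  anc_inj k hk i hi k' hk' i' hi' b b' h := by
    have hlt : ∀ k ≤ L, ∀ i < N, ∀ b : Bool, 2 * (k * N + i) + b.toNat < 2 * (N * (L + 1)) := by
      intro k hk i hi b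
      have h1 : (k + 1) * N ≤ (L + 1) * N := Nat.mul_le_mul_right N (by omega)
      have h2 := Bool.toNat_lt b
      rw [mul_comm N]
      rw [add_mul k] at h1
      omega
    have e := congrArg Fin.val (Sum.inr_injective (Option.some_injective _ h))
    simp only [Fin.ofNat, Nat.mod_eq_of_lt (hlt k hk i hi b),
      Nat.mod_eq_of_lt (hlt k' hk' i' hi' b')] at e
    have h1 := Bool.toNat_lt b
    have h2 := Bool.toNat_lt b'
    -- The index is a mixed-radix expansion; parity recovers `b`, and division by `N` recovers `k`.
    have e1 : k * N + i = k' * N + i' := by omega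
    have e2 : b.toNat = b'.toNat := by omega
    have hdiv : ∀ k i, i < N → (k * N + i) / N = k := fun k i hi => by
      rw [mul_comm, Nat.mul_add_div (by omega), Nat.div_eq_of_lt hi, add_zero]
    have e3 : k = k' := by rw [← hdiv k i hi, e1, hdiv k' i' hi']
    subst e3
    exact ⟨rfl, by omega, by cases b <;> cases b' <;> simp_all⟩
  dat_ne_anc c v k i b h := by simp at h

theorem exists_chiSquared_qnn (n r w q : ℕ) (α : ℝ) [NeZero (n * r)] (p B : ℕ) (hB : 0 < B)
    (hM : n * r * B ≤ 2 ^ p) (hF : ∀ v, cellValue w v ≤ B)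
    (P : ℕ → List (CGate ((Fin w ⊕ Fin w) ⊕ Bool)))
    (hP : ∀ t, CGate.Adds (P t) false fun v => decide (t < cellValue w v)) :
    ∃ N : QNN (TableQubit n r w),
      N.depth ≤ 10 * ((∑ t ∈ Finset.range B, (P t).length) + 2 * p ^ 2) + 6 ∧
      N.size ≤ 10 * (((∑ t ∈ Finset.range B, (P t).length) + 2 * p ^ 2) * 2 ^ p) + 6 ∧
      N.SolvesChiSquaredTest q α := by
  have hpos : 0 < 2 ^ p := by positivity
  set L := (SortColumn.sort p).length with hL
  have : NeZero (2 * (2 ^ p * (L + 1))) := ⟨by positivity⟩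
  let ω := tableWiring n r w L (2 ^ p)
  obtain ⟨Cs, hC, hw, hlen, hsize, hrun⟩ := Wiring.exists_count p B hB hM ω _ hF P hP
  set T := ⌈chiSquaredCritical (degreesOfFreedom n r) α * ((2 ^ w).factorial * 2 ^ q)⌉₊ with hT
  obtain ⟨N, hd, hs, hN⟩ := exists_qnn_of_circuit (2 * (2 ^ p * (L + 1))) Cs hC
    (fun l hl g hg hmem => by
      rcases hw l hl g hg _ hmem with ⟨c, v, h⟩ | ⟨k, i, b, h⟩ <;> exact Option.some_ne_none _ h.symm)
    (Sum.inr (Fin.ofNat _ (2 * (L * 2 ^ p + min (T - 1) (2 ^ p - 1)) + false.toNat)))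
    -- The bit read has index `T - 1` and says `T ≤ sum`, hence the negation. For `T = 0` the test
    -- always fails; for `2 ^ p < T` it always holds, since the sum is at most `2 ^ p`.
    (fun b => if T = 0 then false else if 2 ^ p < T then true else !b)
    (fun d => ∑ c ∈ Finset.range (n * r), cellValue w (fun v => d (tableWire n r w c v)) < T) (by
      intro x hx
      have h := hrun x (fun k i b => hx _) (min (T - 1) (2 ^ p - 1)) (by omega)
      change CGate.run Cs.flatten x (some (Sum.inr (Fin.ofNat _ (2 * (L * 2 ^ p +
        min (T - 1) (2 ^ p - 1)) + false.toNat)))) = decide (_ < ∑ c ∈ Finset.range (n * r),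
          cellValue w fun v => x (some (Sum.inl (tableWire n r w c v)))) at h
      rw [h]
      have hle : ∑ c ∈ Finset.range (n * r),
          cellValue w (fun v => x (some (Sum.inl (tableWire n r w c v)))) ≤ 2 ^ p :=
        ((Finset.sum_le_card_nsmul _ _ B fun c _ => hF _).trans (by simp)).trans hM
      split_ifs with h1 h2
      · simp [h1]
      · simp only [true_iff]; omega
      · simp only [Bool.not_eq_true', decide_eq_false_iff_not]; omega)
  refine ⟨N, ?_, ?_, fun ψ hψ hpos => ⟨fun h => (hN ψ hψ).1 fun d hd => ?_,
    fun h => (hN ψ hψ).2 fun d hd => ?_⟩⟩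
  · rw [hd]; omega
  · have h1 : (Cs.map List.length).sum ≤ Cs.length * 2 ^ p := by
      refine (List.sum_le_card_nsmul _ (2 ^ p) ?_).trans (by simp)
      intro k hk
      obtain ⟨l, hl, rfl⟩ := List.mem_map.1 hk
      exact hsize l hl
    have h2 := h1.trans (Nat.mul_le_mul_right (2 ^ p) hlen)
    omega
  · exact (testHolds_iff q α d (hpos d hd)).1 (h d hd)
  · exact fun hlt => h d hd ((testHolds_iff q α d (hpos d hd)).2 hlt)

/-! ### Bounds -/

/-- The fourth power is what bounds `p ^ 2` by a multiple of `√(2 ^ p)`. From `p = 16` on, `p ^ 4`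
grows by a factor of at most two per step. -/
theorem pow_four_le (p : ℕ) : p ^ 4 ≤ 65536 * 2 ^ p := by
  rcases le_total p 16 with h | h
  · calc p ^ 4 ≤ 16 ^ 4 := Nat.pow_le_pow_left h 4
      _ ≤ 65536 * 2 ^ p := Nat.le_mul_of_pos_right _ (by positivity)
  · induction p, h using Nat.le_induction with
    | base => norm_num
    | succ p hp ih =>
      obtain ⟨k, rfl⟩ := Nat.exists_eq_add_of_le hp
      rw [pow_succ 2]
      have : (16 + k + 1) ^ 4 ≤ 2 * (16 + k) ^ 4 := by
        ring_nf
        omega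
      omega

theorem two_le_and_le_degreesOfFreedom {n r : ℕ} (h : 1 ≤ degreesOfFreedom n r) :
    2 ≤ n * r ∧ n * r ≤ 4 * degreesOfFreedom n r := by
  unfold degreesOfFreedom at *
  split_ifs at * with hr
  · subst hr; omega
  · obtain ⟨h1, h2⟩ := CanonicallyOrderedAdd.mul_pos.1 (Nat.lt_of_lt_of_le one_pos h)
    obtain ⟨a, rfl⟩ := Nat.exists_eq_add_of_le (show 2 ≤ n by omega)
    obtain ⟨b, rfl⟩ := Nat.exists_eq_add_of_le (show 2 ≤ r by omega)
    rw [show 2 + a - 1 = a + 1 by omega, show 2 + b - 1 = b + 1 by omega]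
    constructor <;> nlinarith [Nat.zero_le (a * b)]

end

theorem mainTheorem3 (w : ℕ) :
    ∃ C : ℕ, ∀ n r : ℕ, 1 ≤ degreesOfFreedom n r →
      ∀ (q : ℕ) (α : ℝ), 0 < α → α < 1 →
        ∃ N : QNN (TableQubit n r w),
          (N.depth : ℝ) ≤ C * Real.sqrt (degreesOfFreedom n r : ℝ) ∧
          N.size ≤ C * (n * r) ^ C ∧
          N.SolvesChiSquaredTest q α := by
  obtain ⟨B, hB, hF⟩ : ∃ B, 0 < B ∧ ∀ v, cellValue w v ≤ B :=
    ⟨Finset.univ.sup (cellValue w) + 1, Nat.succ_pos _,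
      fun v => (Finset.le_sup (Finset.mem_univ v)).trans (Nat.le_succ _)⟩
  choose P hP using fun t => CGate.exists_adds fun v => decide (t < cellValue w v)
  set K := ∑ t ∈ Finset.range B, (P t).length
  -- The depth uses `10 * K + 40960 * B + 6`, where `40960 = 20 * 2048` comes from `p ^ 2 ≤ 2048 * B
  -- * √df`. The size uses `20 * K * B + 5242880 * B ^ 2 + 6`, where `5242880 = 10 * 2 * 131072 *
  -- 2`. The exponent only has to be at least two.
  refine ⟨10 * K + 40960 * B + 20 * K * B + 5242880 * B ^ 2 + 6, fun n r hdf q α _ _ => ?_⟩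
  obtain ⟨hM, hMdf⟩ := two_le_and_le_degreesOfFreedom hdf
  have : NeZero (n * r) := ⟨by omega⟩
  set M := n * r with hMdef
  set p := Nat.clog 2 (M * B)
  have hp : 2 ^ p ≤ 2 * (M * B) := by
    have h1 : 1 < M * B := by nlinarith
    have h2 := Nat.pow_pred_clog_lt_self one_lt_two h1
    have h3 : 0 < p := Nat.clog_pos one_lt_two h1
    have h4 : 2 ^ p = 2 * 2 ^ p.pred := by
      rw [← pow_succ', ← Nat.succ_eq_add_one, Nat.succ_pred_eq_of_pos h3]
    change 2 ^ p.pred < M * B at h2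
    omega
  have hp4 := pow_four_le p
  obtain ⟨N, hd, hs, hN⟩ := exists_chiSquared_qnn n r w q α p B hB
    (Nat.le_pow_clog one_lt_two _) hF P hP
  refine ⟨N, ?_, ?_, hN⟩
  · set s := Real.sqrt (degreesOfFreedom n r : ℝ) with hs
    have hs1 : 1 ≤ s := by
      rw [hs, Real.one_le_sqrt]
      exact_mod_cast hdf
    have hss : s ^ 2 = degreesOfFreedom n r := Real.sq_sqrt (Nat.cast_nonneg _)
    have hp2 : (p : ℝ) ^ 2 ≤ 2048 * B * s := by
      refine le_of_sq_le_sq ?_ (by positivity)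
      rw [mul_pow, hss]
      -- Chain `p ^ 4 ≤ 65536 * 2 ^ p`, `2 ^ p ≤ 2 * M * B` and `M ≤ 4 * df`; the factor `2 ^ 19` is
      -- rounded up to the square `2048 ^ 2`.
      have : p ^ 4 ≤ (2048 * B) ^ 2 * degreesOfFreedom n r := by
        have h1 : M * B ≤ 4 * degreesOfFreedom n r * B := Nat.mul_le_mul_right B hMdf
        have h2 : degreesOfFreedom n r * B ≤ degreesOfFreedom n r * B ^ 2 :=
          Nat.mul_le_mul_left _ (Nat.le_self_pow two_ne_zero B)
        nlinarith
      calc ((p : ℝ) ^ 2) ^ 2 = ((p ^ 4 : ℕ) : ℝ) := by push_cast; ring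
        _ ≤ (((2048 * B) ^ 2 * degreesOfFreedom n r : ℕ) : ℝ) := by exact_mod_cast this
        _ = _ := by push_cast; ring
    have hd' : (N.depth : ℝ) ≤ 10 * (K + 2 * (p : ℝ) ^ 2) + 6 := by exact_mod_cast hd
    have h1 : (0 : ℝ) ≤ 20 * K * B + 5242880 * B ^ 2 := by positivity
    have h2 : (0 : ℝ) ≤ 10 * K + 6 := by positivity
    push_cast
    nlinarith [mul_nonneg h1 (zero_le_one.trans hs1), mul_le_mul_of_nonneg_left hs1 h2]
  · have hp2 : p ^ 2 ≤ 131072 * (M * B) := by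
      have : p ^ 2 ≤ p ^ 4 := by
        rcases Nat.eq_zero_or_pos p with h | h
        · simp [h]
        · exact Nat.pow_le_pow_right h (by norm_num)
      omega
    calc N.size ≤ 10 * ((K + 2 * p ^ 2) * 2 ^ p) + 6 := hs
      _ ≤ 10 * ((K + 2 * (131072 * (M * B))) * (2 * (M * B))) + 6 := by gcongr
      _ ≤ (10 * K + 40960 * B + 20 * K * B + 5242880 * B ^ 2 + 6) * M ^ 2 := by
        have h1 : K * B * M ≤ K * B * M ^ 2 :=
          Nat.mul_le_mul_left _ (Nat.le_self_pow two_ne_zero M)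
        have h2 : 1 ≤ M ^ 2 := Nat.one_le_pow _ _ (by omega)
        have h3 : 0 ≤ (10 * K + 40960 * B) * M ^ 2 := Nat.zero_le _
        nlinarith
      _ ≤ _ := Nat.mul_le_mul_left _ (Nat.pow_le_pow_right (by omega) (by omega))
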